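/- Let $1\le k$ and let $L_0\in\mathbb R^{m\times k}$ and $R_0\in\mathbb R^{k\times n}$ have rank $k$. Write $\sigma_i(A)$ for the $i$-th largest singular value of $A$, with $\sigma_i(L_0)=\sigma_i(R_0)=0$ for $i>k$. Let $\mathcal Y$ be the open set of pairs $(L,R)\in\mathbb R^{m\times k}\times\mathbb R^{k\times n}$ in which both $L$ and $R$ have rank $k$, and let $G:\mathcal Y\to\mathbb R^{m\times n}$, $G(L,R)=LR$. All matrix spaces and their products carry the Euclidean (Frobenius) inner product. The least-squares condition number $\kappa^{inv}_{LS}[G](y_0)$ at a point $y_0\in\mathcal Y$ is defined as follows. The map $G$ is smooth of constant rank on $\mathcal Y$. Let $\widehat{\mathcal Y}\subseteq\mathcal Y$ be an open neighbourhood of $y_0$ for which $\mathcal X:=G(\widehat{\mathcal Y})$ is an embedded submanifold of $\mathbb R^{m\times n}$, let $x_0:=G(y_0)$, and let $d_{\mathcal X}$, $d_{\widehat{\mathcal Y}}$ be the geodesic distances of the induced Riemannian metrics. For $x$ in a sufficiently small neighbourhood of $x_0$ in $\mathcal X$ there is a unique point $H(x)\in\widehat{\mathcal Y}$ that minimises $d_{\widehat{\mathcal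 Y}}(y_0,y)$ among all $y\in\widehat{\mathcal Y}$ with $G(y)=x$, and $H$ is smooth. Then $\kappa^{inv}_{LS}[G](y_0)$ is the smallest number $\kappa\ge 0$ such that $$d_{\widehat{\mathcal Y}}(H(x_0),H(x))\le \kappa\, d_{\mathcal X}(x_0,x)+o(d_{\mathcal X}(x_0,x))\quad\text{as } x\to x_0 \text{ in }\mathcal X.$$ Then neighbourhoods $\widehat{\mathcal Y}$ as above exist, this number exists and does not depend on the choice of $\widehat{\mathcal Y}$, and $$\kappa^{inv}_{LS}[G](L_0,R_0)=\frac{1}{\sqrt{\min\{\sigma_k(L_0)^2+\sigma_n(R_0)^2,\ \sigma_m(L_0)^2+\sigma_k(R_0)^2\}}}.$$ If $k<\min\{m,n\}$, then $\kappa^{inv}_{LS}[G](L_0,R_0)=1/\min\{\sigma_k(L_0),\sigma_k(R_0)\}$. -/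

import Mathlib

open scoped Topology ContDiff

noncomputable section

namespace LSCond

/-- The `i`-th largest singular value (`i = 1, 2, …`) of a real matrix; it is `0` for every `i`
larger than the rank. Mathlib numbers singular values from `0`. -/
def sigma {p q : ℕ} (A : Matrix (Fin p) (Fin q) ℝ) (i : ℕ) : ℝ :=
  (Matrix.toEuclideanLin A).singularValues (i - 1)

section General

variable {E E' Z : Type*} [NormedAddCommGroup E] [NormedSpace ℝ E]
  [NormedAddCommGroup E'] [NormedSpace ℝ E']

/-- Length of a `C¹` path parametrised by `[0, 1]`. -/
def pathLength (γ : ℝ → E) : ENNReal :=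
  ∫⁻ t in Set.Icc (0 : ℝ) 1, ‖derivWithin γ (Set.Icc (0 : ℝ) 1) t‖ₑ

/-- Geodesic distance in a submanifold `S` of a Euclidean space `E`, for the metric that `S`
inherits from `E`: the infimum of the lengths of the `C¹` paths inside `S` from `x` to `y`
(`∞` if there are none). -/
def geodesicEDist (S : Set E) (x y : E) : ENNReal :=
  ⨅ (γ : ℝ → E) (_ : ContDiffOn ℝ 1 γ (Set.Icc (0 : ℝ) 1) ∧
    Set.MapsTo γ (Set.Icc (0 : ℝ) 1) S ∧ γ 0 = x ∧ γ 1 = y), pathLength γ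

/-- `S` is an embedded smooth submanifold (of some dimension `d`) of the vector space `E`:
near each of its points a diffeomorphism between open subsets of `E` straightens `S` to a
`d`-dimensional linear subspace. -/
def IsEmbeddedSubmanifold (S : Set E) : Prop :=
  ∃ d : ℕ, ∀ x ∈ S, ∃ (φ : OpenPartialHomeomorph E E) (V : Submodule ℝ E),
    x ∈ φ.source ∧ ContDiffOn ℝ ∞ φ φ.source ∧ ContDiffOn ℝ ∞ φ.symm φ.target ∧
    FiniteDimensional ℝ V ∧ Module.finrank ℝ V = d ∧ ∀ z ∈ φ.source, z ∈ S ↔ φ z ∈ V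

/-- `κ` is the condition number at `x₀` of the map `H`, defined on the set `S`, for the distances
`dX` and `dY`: it is the smallest number `κ ≥ 0` such that
`dY (H x₀) (H x) ≤ κ * dX x₀ x + o(dX x₀ x)` as `x → x₀` in `S`. -/
def IsConditionNumber (dX : E' → E' → ENNReal) (dY : E → E → ENNReal) (S : Set E')
    (H : E' → E) (x₀ : E') (κ : ℝ) : Prop :=
  IsLeast {κ : ℝ | 0 ≤ κ ∧ ∀ ε : ℝ, 0 < ε → ∀ᶠ x in 𝓝[S] x₀,
    dY (H x₀) (H x) ≤ ENNReal.ofReal (κ + ε) * dX x₀ x} κ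

/-- `H` is a least-squares solution map of the system `F x y = c`, `x ∈ X`, `y ∈ Y`, for the
starting point `y₀`, on the neighbourhood `X ∩ U` of `x₀` in `X`: it is smooth, and `H x` is
the solution `y ∈ Y` of `F x y = c` that minimises the geodesic distance to `y₀` in `Y`. -/
structure IsLSSolutionMap (X : Set E') (Y : Set E) (F : E' → E → Z) (c : Z)
    (x₀ : E') (y₀ : E) (U : Set E') (H : E' → E) : Prop where
  isOpen : IsOpen U
  mem : x₀ ∈ U
  smooth : ContDiffOn ℝ ∞ H (X ∩ U)
  mapsTo : ∀ x ∈ X ∩ U, H x ∈ Y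
  solves : ∀ x ∈ X ∩ U, F x (H x) = c
  minimises : ∀ x ∈ X ∩ U, ∀ y ∈ Y, F x y = c → y ≠ H x →
    geodesicEDist Y y₀ (H x) < geodesicEDist Y y₀ y

/-- The least-squares condition number of the system `F x y = c`, `x ∈ X`, `y ∈ Y`, at its
solution `(x₀, y₀)` exists and is `κ`: there is a least-squares solution map near `x₀`, and every
such map has condition number `κ` at `x₀` for the geodesic distances in `X` and `Y`. -/
def HasLSConditionNumber (X : Set E') (Y : Set E) (F : E' → E → Z) (c : Z)
    (x₀ : E') (y₀ : E) (κ : ℝ) : Prop :=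
  (∃ U H, IsLSSolutionMap X Y F c x₀ y₀ U H) ∧
    ∀ U H, IsLSSolutionMap X Y F c x₀ y₀ U H →
      IsConditionNumber (geodesicEDist X) (geodesicEDist Y) (X ∩ U) H x₀ κ

/-- `G` is a smooth map of constant rank on the open set `D`. -/
def IsConstantRankMap (G : E → E') (D : Set E) : Prop :=
  IsOpen D ∧ ContDiffOn ℝ ∞ G D ∧
    ∃ r : ℕ, ∀ y ∈ D, Module.finrank ℝ (LinearMap.range (fderiv ℝ G y : E →ₗ[ℝ] E')) = r

/-- `W` is a neighbourhood of `y₀` in `D` whose image under `G` is an embedded submanifold. -/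
def IsAdmissible (G : E → E') (D : Set E) (y₀ : E) (W : Set E) : Prop :=
  IsOpen W ∧ y₀ ∈ W ∧ W ⊆ D ∧ IsEmbeddedSubmanifold (G '' W)

/-- The least-squares condition number of the constant-rank inverse problem `G y - x = 0` with
`G : D → E'` exists at `y₀` and is `κ`. Here `y` is restricted to a neighbourhood `W` of `y₀` for
which `G '' W` is an embedded submanifold, and `x` ranges over `G '' W`; such `W` exist, and the
value is the same for all of them. -/
def HasLSInvConditionNumber (G : E → E') (D : Set E) (y₀ : E) (κ : ℝ) : Prop :=
  IsConstantRankMap G D ∧ (∃ W, IsAdmissible G D y₀ W) ∧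
    ∀ W, IsAdmissible G D y₀ W →
      HasLSConditionNumber (G '' W) W (fun x y => G y - x) 0 (G y₀) y₀ κ

end General

/-- The space of real `p × q` matrices with the Euclidean (Frobenius) inner product. -/
abbrev MatSpace (p q : ℕ) : Type := EuclideanSpace ℝ (Fin p × Fin q)

/-- A matrix as a point of `MatSpace p q`. -/
def ofMat {p q : ℕ} (A : Matrix (Fin p) (Fin q) ℝ) : MatSpace p q :=
  WithLp.toLp 2 fun ij => A ij.1 ij.2

/-- A point of `MatSpace p q` as a matrix. -/
def toMat {p q : ℕ} (x : MatSpace p q) : Matrix (Fin p) (Fin q) ℝ :=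
  Matrix.of fun i j => x (i, j)

/-- The space of pairs `(L, R)` of an `m × k` and a `k × n` matrix, with the Euclidean inner
product `⟨L, L'⟩ + ⟨R, R'⟩`. -/
abbrev FactorSpace (m k n : ℕ) : Type := WithLp 2 (MatSpace m k × MatSpace k n)

/-- A pair of matrices as a point of `FactorSpace m k n`. -/
def ofPair {m k n : ℕ} (L : Matrix (Fin m) (Fin k) ℝ) (R : Matrix (Fin k) (Fin n) ℝ) :
    FactorSpace m k n :=
  WithLp.toLp 2 (ofMat L, ofMat R)

/-- The map `(L, R) ↦ L R`. -/
def productMap (m k n : ℕ) (y : FactorSpace m k n) : MatSpace m n :=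
  ofMat (toMat y.fst * toMat y.snd)

/-- The pairs `(L, R)` in which both matrices have rank `k`. -/
def fullRankPairs (m k n : ℕ) : Set (FactorSpace m k n) :=
  {y | (toMat y.fst).rank = k ∧ (toMat y.snd).rank = k}

end LSCond

end

noncomputable section

namespace LSCond

/-! ### Geodesic distance against norm distance. -/

section Geodesic

open Set Filter

variable {E E' : Type*} [NormedAddCommGroup E] [NormedSpace ℝ E]
  [NormedAddCommGroup E'] [NormedSpace ℝ E']

/-! Write `y₀ = (L, R)` and `μ = minSq L R`. The condition number is the reciprocal of the smallest
nonzero singular value of `DG(y₀)`: with `DG(a, b) = a R + L b` and adjoint `DG* X = (X Rᵀ, Lᵀ X)`,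
the operator `DG DG*` is `X ↦ X Rᵀ R + L Lᵀ X`. Its eigenvalues are the sums `σ_i(L)² + σ_j(R)²`,
which vanish only if `i, j > k`, so the least nonzero one is `μ`.

Geodesic distance in an open set dominates norm distance and equals it near `y₀`, so it suffices to
find norm-closest points of the fibres (`hasLSConditionNumber_of_section`). The displacement `y -
y₀` is normal to the fibre exactly when `balance L R y = 0`. The derivative of `balance` at `y₀` is
`K*(a, b) = Lᵀ a - b Rᵀ`, where `K C = (L C, -C R)` spans `ker DG`. Since `DG* DG + K K*` is
positive definite, the inverse function theorem applied to `normalMap` yields a smooth balanced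
section (`exists_balanced_section`). Balanced points near `y₀` have a Lagrange multiplier of norm
below 1, which forces strict minimality on the whole fibre, not only locally
(`norm_sub_lt_of_multiplier`).

For the upper bound, `‖DG δ‖² + ‖K* δ‖² ≥ μ ‖δ‖²`, and `K* δ` is of second order when `y₀ + δ` is
balanced. For the lower bound, take a `μ`-eigenmatrix `X` of `DG DG*` and follow `t ↦ G(y₀ + t v)`
with `v = DG* X`: every solution over this curve is at distance at least `t ‖v‖ - O(t²)`, while the
curve has speed `μ ‖X‖ = √μ ‖v‖` at 0. -/

theorem enorm_sub_le_geodesicEDist (S : Set E) (x y : E) :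
    ‖y - x‖ₑ ≤ geodesicEDist S x y := by
  refine le_iInf₂ fun γ hγ => ?_
  obtain ⟨h1, -, rfl, rfl⟩ := hγ
  exact enorm_sub_le_lintegral_derivWithin_Icc_of_contDiffOn_Icc h1 zero_le_one

theorem pathLength_le {γ : ℝ → E} {C : ENNReal}
    (h : ∀ t ∈ Icc (0 : ℝ) 1, ‖derivWithin γ (Icc (0 : ℝ) 1) t‖ₑ ≤ C) : pathLength γ ≤ C := by
  refine (MeasureTheory.setLIntegral_mono measurable_const h).trans ?_
  simp

theorem geodesicEDist_le {S : Set E} {γ : ℝ → E} {C : ENNReal} (hγ : ContDiff ℝ 1 γ)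
    (hS : ∀ t ∈ Icc (0 : ℝ) 1, γ t ∈ S) (h : ∀ t ∈ Icc (0 : ℝ) 1, ‖deriv γ t‖ₑ ≤ C) :
    geodesicEDist S (γ 0) (γ 1) ≤ C := by
  refine (iInf₂_le γ ⟨hγ.contDiffOn, hS, rfl, rfl⟩).trans (pathLength_le fun t ht => ?_)
  have hd := (hγ.differentiable (by simp) t).derivWithin
    (uniqueDiffOn_Icc (zero_lt_one : (0 : ℝ) < 1) t ht)
  rw [hd]
  exact h t ht

theorem geodesicEDist_eq_enorm_of_segment_subset {S : Set E} {x y : E} (h : segment ℝ x y ⊆ S) :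
    geodesicEDist S x y = ‖y - x‖ₑ := by
  refine le_antisymm ?_ (enorm_sub_le_geodesicEDist S x y)
  have key := geodesicEDist_le (S := S) (γ := fun t : ℝ => x + t • (y - x)) (C := ‖y - x‖ₑ)
    (by fun_prop)
    (fun t ht => h (by rw [segment_eq_image']; exact ⟨t, ht, rfl⟩))
    (fun t _ => by
      have : HasDerivAt (fun t : ℝ => x + t • (y - x)) ((1 : ℝ) • (y - x)) t :=
        ((hasDerivAt_id t).smul_const _).const_add _
      rw [this.deriv, one_smul])
  simpa using key

theorem geodesicEDist_eq_enorm_of_mem_ball {S : Set E} {x y : E} {r : ℝ}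
    (h : Metric.ball x r ⊆ S) (hy : y ∈ Metric.ball x r) : geodesicEDist S x y = ‖y - x‖ₑ :=
  geodesicEDist_eq_enorm_of_segment_subset
    (((convex_ball x r).segment_subset
      (Metric.mem_ball_self (Metric.pos_of_mem_ball hy)) hy).trans h)

/-- The geodesic distance along a curve is asymptotically at most the speed times the time. -/
theorem eventually_geodesicEDist_curve_le {X : Set E'} {c : ℝ → E'} (hc : ContDiff ℝ 1 c)
    (hX : ∀ᶠ t in 𝓝 0, c t ∈ X) {s : ℝ} (hs : ‖deriv c 0‖ < s) :
    ∀ᶠ t in 𝓝[>] (0 : ℝ), geodesicEDist X (c 0) (c t) ≤ ENNReal.ofReal (t * s) := by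
  have h1 : ∀ᶠ t in 𝓝 (0 : ℝ), ‖deriv c t‖ < s :=
    (hc.continuous_deriv le_rfl).norm.continuousAt.eventually_lt continuousAt_const hs
  obtain ⟨r, hr, hball⟩ := Metric.eventually_nhds_iff_ball.1 (h1.and hX)
  filter_upwards [Ioo_mem_nhdsGT hr] with t ht
  have hmem : ∀ τ ∈ Icc (0 : ℝ) 1, t * τ ∈ Metric.ball (0 : ℝ) r := by
    intro τ hτ
    rw [Metric.mem_ball, dist_zero_right, Real.norm_eq_abs, abs_of_nonneg
      (mul_nonneg ht.1.le hτ.1)]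
    exact (mul_le_of_le_one_right ht.1.le hτ.2).trans_lt ht.2
  -- Rescaling time to `[0, 1]` multiplies the speed by `t`.
  have key := geodesicEDist_le (S := X) (γ := fun τ : ℝ => c (t * τ))
    (C := ENNReal.ofReal (t * s)) (by fun_prop) (fun τ hτ => (hball _ (hmem τ hτ)).2)
    (fun τ hτ => by
      have h2 : HasDerivAt (fun τ : ℝ => t * τ) t τ := by
        simpa using (hasDerivAt_id τ).const_mul t
      have h3 : HasDerivAt (fun τ : ℝ => c (t * τ)) (t • deriv c (t * τ)) τ :=
        ((hc.differentiable (by simp) (t * τ)).hasDerivAt).scomp τ h2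
      rw [h3.deriv, ← ofReal_norm, norm_smul, Real.norm_eq_abs, abs_of_pos ht.1]
      exact ENNReal.ofReal_le_ofReal
        (mul_le_mul_of_nonneg_left (hball _ (hmem τ hτ)).1.le ht.1.le))
  simpa using key

end Geodesic

/-! ### Reduction of the condition number to norm-closest points. -/

section Criterion

open Set Filter

variable {E E' : Type*} [NormedAddCommGroup E] [NormedSpace ℝ E]
  [NormedAddCommGroup E'] [NormedSpace ℝ E']

/-- A smooth local section `H₀` of `G` whose values are the points of the fibres strictly closest
to `y₀` in norm determines the least-squares condition number. -/
theorem hasLSConditionNumber_of_section {G : E → E'} {W : Set E} {y₀ : E} {r κ : ℝ}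
    {V : Set E'} {H₀ : E' → E} {c : ℝ → E'}
    (hr : Metric.ball y₀ r ⊆ W) (hVo : IsOpen V) (hV : G y₀ ∈ V)
    (hsm : ContDiffOn ℝ ∞ H₀ V)
    (hball : ∀ x ∈ G '' W ∩ V, H₀ x ∈ Metric.ball y₀ r)
    (hsol : ∀ x ∈ G '' W ∩ V, G (H₀ x) = x)
    (hmin : ∀ x ∈ G '' W ∩ V, ∀ y ∈ W, G y = x → y ≠ H₀ x → ‖H₀ x - y₀‖ < ‖y - y₀‖)
    (hκ : 0 ≤ κ)
    (hup : ∀ ε : ℝ, 0 < ε → ∀ᶠ x in 𝓝[G '' W] (G y₀), ‖H₀ x - y₀‖ ≤ (κ + ε) * ‖x - G y₀‖)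
    (hc : ContDiff ℝ 1 c) (hc0 : c 0 = G y₀) (hcX : ∀ᶠ t in 𝓝 0, c t ∈ G '' W)
    (hc' : deriv c 0 ≠ 0)
    (hlow : ∀ (M : ℝ) (y : ℝ → E), (∀ᶠ t in 𝓝[>] (0 : ℝ), G (y t) = c t ∧ ‖y t - y₀‖ ≤ M * t) →
      κ * ‖deriv c 0‖ ≤ M) :
    HasLSConditionNumber (G '' W) W (fun x y => G y - x) 0 (G y₀) y₀ κ := by
  have hgeo : ∀ y ∈ Metric.ball y₀ r, geodesicEDist W y₀ y = ‖y - y₀‖ₑ :=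
    fun y hy => geodesicEDist_eq_enorm_of_mem_ball hr hy
  have hstrict : ∀ x ∈ G '' W ∩ V, ∀ y ∈ W, G y = x → y ≠ H₀ x →
      geodesicEDist W y₀ (H₀ x) < geodesicEDist W y₀ y := by
    intro x hx y hy hGy hne
    rw [hgeo _ (hball x hx)]
    refine lt_of_lt_of_le ?_ (enorm_sub_le_geodesicEDist W y₀ y)
    rw [← ofReal_norm, ← ofReal_norm, ENNReal.ofReal_lt_ofReal_iff_of_nonneg (norm_nonneg _)]
    exact hmin x hx y hy hGy hne
  refine ⟨⟨V, H₀, hVo, hV, hsm.mono inter_subset_right, fun x hx => hr (hball x hx),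
    fun x hx => sub_eq_zero.2 (hsol x hx),
    fun x hx y hy h hne => hstrict x hx y hy (sub_eq_zero.1 h) hne⟩, ?_⟩
  intro U H hH
  have hy₀r : y₀ ∈ Metric.ball y₀ r := by
    have : c 0 ∈ G '' W := hcX.self_of_nhds
    exact Metric.mem_ball_self (Metric.pos_of_mem_ball (hball _ ⟨hc0 ▸ this, hV⟩))
  have hy₀W : y₀ ∈ W := hr hy₀r
  have hx₀ : G y₀ ∈ G '' W := mem_image_of_mem G hy₀W
  -- Otherwise `y₀`, a solution at distance 0 from itself, would be strictly farther away than `H (G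
  -- y₀)`.
  have hH0 : H (G y₀) = y₀ := by
    by_contra hne
    have := hH.minimises (G y₀) ⟨hx₀, hH.mem⟩ y₀ hy₀W (sub_self _) (Ne.symm hne)
    rw [hgeo y₀ hy₀r] at this
    simp at this
  -- Two strict minimisers on the same fibre coincide, so every solution map agrees with `H₀` near
  -- `G y₀`.
  have heq : ∀ x ∈ G '' W, x ∈ U → x ∈ V → H x = H₀ x := by
    intro x hx hxU hxV
    by_contra hne
    exact lt_asymm (hstrict x ⟨hx, hxV⟩ (H x) (hH.mapsTo x ⟨hx, hxU⟩)
      (sub_eq_zero.1 (hH.solves x ⟨hx, hxU⟩)) hne)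
      (hH.minimises x ⟨hx, hxU⟩ (H₀ x) (hr (hball x ⟨hx, hxV⟩))
        (sub_eq_zero.2 (hsol x ⟨hx, hxV⟩)) (Ne.symm hne))
  rw [IsConditionNumber, hH0]
  refine ⟨⟨hκ, fun ε hε => ?_⟩, ?_⟩
  · have h1 := (hup ε hε).filter_mono (nhdsWithin_mono (G y₀) (inter_subset_left (t := U)))
    filter_upwards [h1, self_mem_nhdsWithin, mem_nhdsWithin_of_mem_nhds (hVo.mem_nhds hV)]
      with x hx hxU hxV
    rw [heq x hxU.1 hxU.2 hxV, hgeo _ (hball x ⟨hxU.1, hxV⟩)]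
    calc ‖H₀ x - y₀‖ₑ = ENNReal.ofReal ‖H₀ x - y₀‖ := (ofReal_norm _).symm
      _ ≤ ENNReal.ofReal ((κ + ε) * ‖x - G y₀‖) := ENNReal.ofReal_le_ofReal hx
      _ = ENNReal.ofReal (κ + ε) * ‖x - G y₀‖ₑ := by
        rw [ENNReal.ofReal_mul (by positivity), ofReal_norm]
      _ ≤ _ := by gcongr; exact enorm_sub_le_geodesicEDist _ _ _
  · rintro κ' ⟨hκ', hev⟩
    set s := ‖deriv c 0‖ with hs
    have hspos : 0 < s := norm_pos_iff.2 hc'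
    -- Test an admissible `κ'` on the curve `c`, whose geodesic distance from `G y₀` is at most `t
    -- (s + ε)`; then let `ε → 0`.
    have hMε : ∀ ε : ℝ, 0 < ε → κ * s ≤ (κ' + ε) * (s + ε) := by
      intro ε hε
      refine hlow _ (fun t => H (c t)) ?_
      have hcU : ∀ᶠ t in 𝓝 (0 : ℝ), c t ∈ U :=
        hc.continuous.continuousAt.eventually_mem (hH.isOpen.mem_nhds (hc0 ▸ hH.mem))
      have htend : Tendsto c (𝓝[>] 0) (𝓝[G '' W ∩ U] (G y₀)) := by
        refine tendsto_nhdsWithin_iff.2 ⟨?_, ?_⟩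
        · rw [← hc0]
          exact hc.continuous.continuousAt.tendsto.mono_left nhdsWithin_le_nhds
        · exact (hcX.and hcU).filter_mono nhdsWithin_le_nhds
      filter_upwards [htend.eventually (hev ε hε),
        eventually_geodesicEDist_curve_le hc hcX (lt_add_of_pos_right s hε),
        (hcX.and hcU).filter_mono nhdsWithin_le_nhds, self_mem_nhdsWithin] with t h1 h2 h3 h4
      refine ⟨sub_eq_zero.1 (hH.solves _ h3), ?_⟩
      rw [hc0] at h2
      have h5 : ‖H (c t) - y₀‖ₑ ≤ ENNReal.ofReal ((κ' + ε) * (t * (s + ε))) :=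
        calc _ ≤ _ := enorm_sub_le_geodesicEDist W _ _
          _ ≤ _ := h1
          _ ≤ ENNReal.ofReal (κ' + ε) * ENNReal.ofReal (t * (s + ε)) := by gcongr
          _ = _ := (ENNReal.ofReal_mul (by positivity)).symm
      have ht : (0 : ℝ) < t := h4
      rw [← ofReal_norm, ENNReal.ofReal_le_ofReal_iff (by positivity)] at h5
      linarith
    have hlim : Tendsto (fun ε : ℝ => (κ' + ε) * (s + ε)) (𝓝[>] 0) (𝓝 ((κ' + 0) * (s + 0))) :=
      (Continuous.tendsto (by fun_prop) 0).mono_left nhdsWithin_le_nhds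
    have := ge_of_tendsto hlim (by
      filter_upwards [self_mem_nhdsWithin] with ε hε using hMε ε hε)
    rw [add_zero, add_zero] at this
    exact le_of_mul_le_mul_right this hspos

end Criterion

/-! ### Frobenius norm, trace identities and smoothness of matrix operations. -/

section Frobenius

open Matrix

attribute [local instance] Matrix.frobeniusNormedAddCommGroup Matrix.frobeniusNormedSpace

variable {p q r : ℕ}

theorem toMat_ofMat (A : Matrix (Fin p) (Fin q) ℝ) : toMat (ofMat A) = A := rfl

theorem ofMat_injective : Function.Injective (ofMat : Matrix (Fin p) (Fin q) ℝ → MatSpace p q) :=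
  Function.LeftInverse.injective toMat_ofMat

theorem inner_ofMat (A B : Matrix (Fin p) (Fin q) ℝ) :
    inner ℝ (ofMat A) (ofMat B) = (Aᵀ * B).trace := by
  simp only [ofMat, PiLp.inner_apply, RCLike.inner_apply, conj_trivial, Fintype.sum_prod_type,
    trace, diag, mul_apply, transpose_apply]
  rw [Finset.sum_comm]
  exact Finset.sum_congr rfl fun _ _ => Finset.sum_congr rfl fun _ _ => mul_comm _ _

theorem norm_ofMat (A : Matrix (Fin p) (Fin q) ℝ) : ‖ofMat A‖ = ‖A‖ := by
  rw [EuclideanSpace.norm_eq, Matrix.frobenius_norm_def, Real.sqrt_eq_rpow]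
  simp [ofMat, Fintype.sum_prod_type]

theorem norm_toMat (x : MatSpace p q) : ‖toMat x‖ = ‖x‖ := (norm_ofMat (toMat x)).symm

theorem frobenius_norm_sq_eq_trace (A : Matrix (Fin p) (Fin q) ℝ) : ‖A‖ ^ 2 = (Aᵀ * A).trace := by
  rw [← inner_ofMat, real_inner_self_eq_norm_sq, norm_ofMat]

theorem abs_trace_transpose_mul_le (A B : Matrix (Fin p) (Fin q) ℝ) :
    |(Aᵀ * B).trace| ≤ ‖A‖ * ‖B‖ := by
  rw [← inner_ofMat, ← norm_ofMat, ← norm_ofMat]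
  exact abs_real_inner_le_norm _ _

theorem trace_transpose_mul_comm (A B : Matrix (Fin p) (Fin q) ℝ) :
    (Aᵀ * B).trace = (Bᵀ * A).trace := by
  rw [← inner_ofMat, ← inner_ofMat, real_inner_comm]

theorem frobenius_norm_add_sq (A B : Matrix (Fin p) (Fin q) ℝ) :
    ‖A + B‖ ^ 2 = ‖A‖ ^ 2 + 2 * (Aᵀ * B).trace + ‖B‖ ^ 2 := by
  simp only [frobenius_norm_sq_eq_trace, transpose_add, Matrix.add_mul, Matrix.mul_add, trace_add]
  rw [trace_transpose_mul_comm B A]; ring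

theorem frobenius_norm_sub_sq (A B : Matrix (Fin p) (Fin q) ℝ) :
    ‖A - B‖ ^ 2 = ‖A‖ ^ 2 - 2 * (Aᵀ * B).trace + ‖B‖ ^ 2 := by
  simp only [frobenius_norm_sq_eq_trace, transpose_sub, Matrix.sub_mul, Matrix.mul_sub, trace_sub]
  rw [trace_transpose_mul_comm B A]; ring

variable (p q) in
/-- `toMat` as a continuous linear equivalence. -/
def toMatL : MatSpace p q ≃L[ℝ] Matrix (Fin p) (Fin q) ℝ :=
  LinearEquiv.toContinuousLinearEquiv
    { toFun := toMat
      invFun := ofMat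
      map_add' := fun _ _ => rfl
      map_smul' := fun _ _ => rfl
      left_inv := fun _ => rfl
      right_inv := fun _ => rfl }

variable {F : Type*} [NormedAddCommGroup F] [NormedSpace ℝ F] {N : WithTop ℕ∞}

theorem contDiff_toMat : ContDiff ℝ N (toMat : MatSpace p q → Matrix (Fin p) (Fin q) ℝ) :=
  (toMatL p q).contDiff

theorem contDiff_ofMat : ContDiff ℝ N (ofMat : Matrix (Fin p) (Fin q) ℝ → MatSpace p q) :=
  (toMatL p q).symm.contDiff

theorem isBoundedBilinearMap_matrix_mul :
    IsBoundedBilinearMap ℝ (fun P : Matrix (Fin p) (Fin q) ℝ × Matrix (Fin q) (Fin r) ℝ =>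
      P.1 * P.2) where
  add_left _ _ _ := Matrix.add_mul _ _ _
  smul_left _ _ _ := Matrix.smul_mul _ _ _
  add_right _ _ _ := Matrix.mul_add _ _ _
  smul_right _ _ _ := Matrix.mul_smul _ _ _
  bound := ⟨1, one_pos, fun A B => by simpa using Matrix.frobenius_norm_mul A B⟩

theorem _root_.ContDiffAt.matrix_mul {f : F → Matrix (Fin p) (Fin q) ℝ}
    {g : F → Matrix (Fin q) (Fin r) ℝ} {x : F} (hf : ContDiffAt ℝ N f x)
    (hg : ContDiffAt ℝ N g x) : ContDiffAt ℝ N (fun x => f x * g x) x :=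
  (isBoundedBilinearMap_matrix_mul.contDiff (n := N)).contDiffAt.comp x (hf.prodMk hg)

theorem _root_.ContDiff.matrix_mul {f : F → Matrix (Fin p) (Fin q) ℝ}
    {g : F → Matrix (Fin q) (Fin r) ℝ} (hf : ContDiff ℝ N f)
    (hg : ContDiff ℝ N g) : ContDiff ℝ N (fun x => f x * g x) :=
  contDiff_iff_contDiffAt.2 fun _ => hf.contDiffAt.matrix_mul hg.contDiffAt

theorem _root_.ContDiff.matrix_transpose {f : F → Matrix (Fin p) (Fin q) ℝ}
    (hf : ContDiff ℝ N f) : ContDiff ℝ N (fun x => (f x)ᵀ) :=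
  (LinearMap.toContinuousLinearMap
    (Matrix.transposeLinearEquiv (Fin p) (Fin q) ℝ ℝ).toLinearMap).contDiff.comp hf

end Frobenius

section Inverse

open Matrix

attribute [local instance] Matrix.frobeniusNormedRing Matrix.frobeniusNormedAlgebra

theorem contDiffAt_matrix_inv {k : ℕ} {N : WithTop ℕ∞} {A : Matrix (Fin k) (Fin k) ℝ}
    (hA : IsUnit A.det) : ContDiffAt ℝ N (fun A : Matrix (Fin k) (Fin k) ℝ => A⁻¹) A := by
  obtain ⟨u, rfl⟩ := (Matrix.isUnit_iff_isUnit_det A).2 hA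
  have : (fun A : Matrix (Fin k) (Fin k) ℝ => A⁻¹) = Ring.inverse := by
    funext B
    exact Matrix.nonsing_inv_eq_ringInverse B
  rw [this]
  exact contDiffAt_ringInverse ℝ u

end Inverse

section Frobenius

open Matrix

attribute [local instance] Matrix.frobeniusNormedAddCommGroup Matrix.frobeniusNormedSpace

variable {F : Type*} [NormedAddCommGroup F] [NormedSpace ℝ F] {N : WithTop ℕ∞} {k : ℕ}

theorem _root_.ContDiffAt.matrix_inv {f : F → Matrix (Fin k) (Fin k) ℝ} {x : F}
    (hf : ContDiffAt ℝ N f x) (hx : IsUnit (f x).det) :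
    ContDiffAt ℝ N (fun x => (f x)⁻¹) x :=
  (contDiffAt_matrix_inv hx).comp x hf

variable {m n : ℕ}

theorem norm_sq_factorSpace (y : FactorSpace m k n) :
    ‖y‖ ^ 2 = ‖toMat y.fst‖ ^ 2 + ‖toMat y.snd‖ ^ 2 := by
  rw [WithLp.prod_norm_sq_eq_of_L2, norm_toMat, norm_toMat]

theorem inner_factorSpace (y z : FactorSpace m k n) :
    inner ℝ y z = ((toMat y.fst)ᵀ * toMat z.fst).trace + ((toMat y.snd)ᵀ * toMat z.snd).trace := by
  rw [WithLp.prod_inner_apply, ← inner_ofMat, ← inner_ofMat]; rfl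

theorem contDiff_fst_toMat :
    ContDiff ℝ N (fun y : FactorSpace m k n => toMat y.fst) :=
  contDiff_toMat.comp (WithLp.fstL 2 ℝ (MatSpace m k) (MatSpace k n)).contDiff

theorem contDiff_snd_toMat :
    ContDiff ℝ N (fun y : FactorSpace m k n => toMat y.snd) :=
  contDiff_toMat.comp (WithLp.sndL 2 ℝ (MatSpace m k) (MatSpace k n)).contDiff

theorem continuous_fst_toMat : Continuous (fun y : FactorSpace m k n => toMat y.fst) :=
  (contDiff_fst_toMat (N := 0)).continuous

theorem continuous_snd_toMat : Continuous (fun y : FactorSpace m k n => toMat y.snd) :=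
  (contDiff_snd_toMat (N := 0)).continuous

theorem contDiff_ofPair :
    ContDiff ℝ N (fun P : Matrix (Fin m) (Fin k) ℝ × Matrix (Fin k) (Fin n) ℝ =>
      ofPair P.1 P.2) :=
  (WithLp.prodContinuousLinearEquiv 2 ℝ (MatSpace m k) (MatSpace k n)).symm.contDiff.comp
    ((contDiff_ofMat.comp contDiff_fst).prodMk (contDiff_ofMat.comp contDiff_snd))

theorem contDiff_productMap : ContDiff ℝ N (productMap m k n) :=
  contDiff_ofMat.comp (contDiff_fst_toMat.matrix_mul contDiff_snd_toMat)

end Frobenius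

/-! ### Full rank as invertibility of Gram matrices. -/

section Rank

open Matrix

variable {p q k m n : ℕ}

/-- A Gram matrix has the rank of its factor. The determinant form makes full rank an open condition
and supplies smooth one-sided inverses. -/
theorem rank_eq_width_iff_isUnit (A : Matrix (Fin p) (Fin k) ℝ) :
    A.rank = k ↔ IsUnit (Aᵀ * A).det := by
  rw [← Matrix.rank_transpose_mul_self, ← Matrix.isUnit_iff_isUnit_det]
  constructor
  · intro h
    rw [← Matrix.mulVec_surjective_iff_isUnit]
    have h2 : LinearMap.range (Aᵀ * A).mulVecLin = ⊤ := by
      apply Submodule.eq_top_of_finrank_eq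
      rw [← Matrix.rank, h, Module.finrank_fin_fun]
    exact LinearMap.range_eq_top.1 h2
  · intro h
    simpa using Matrix.rank_of_isUnit _ h

theorem rank_eq_height_iff_isUnit (A : Matrix (Fin k) (Fin q) ℝ) :
    A.rank = k ↔ IsUnit (A * Aᵀ).det := by
  simpa using rank_eq_width_iff_isUnit Aᵀ

/-- A left inverse of a matrix of full column rank. -/
def leftInv (A : Matrix (Fin p) (Fin k) ℝ) : Matrix (Fin k) (Fin p) ℝ := (Aᵀ * A)⁻¹ * Aᵀ

/-- A right inverse of a matrix of full row rank. -/
def rightInv (A : Matrix (Fin k) (Fin q) ℝ) : Matrix (Fin q) (Fin k) ℝ := Aᵀ * (A * Aᵀ)⁻¹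

theorem leftInv_mul {A : Matrix (Fin p) (Fin k) ℝ} (hA : A.rank = k) : leftInv A * A = 1 := by
  rw [leftInv, Matrix.mul_assoc, Matrix.nonsing_inv_mul _ ((rank_eq_width_iff_isUnit A).1 hA)]

theorem mul_rightInv {A : Matrix (Fin k) (Fin q) ℝ} (hA : A.rank = k) : A * rightInv A = 1 := by
  rw [rightInv, ← Matrix.mul_assoc, Matrix.mul_nonsing_inv _ ((rank_eq_height_iff_isUnit A).1 hA)]

theorem mul_left_cancel_of_rank {A : Matrix (Fin p) (Fin k) ℝ} (hA : A.rank = k)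
    {B C : Matrix (Fin k) (Fin q) ℝ} (h : A * B = A * C) : B = C := by
  simpa [← Matrix.mul_assoc, leftInv_mul hA] using congrArg (leftInv A * ·) h

theorem isOpen_fullRankPairs : IsOpen (fullRankPairs m k n) := by
  have h : fullRankPairs m k n = {y : FactorSpace m k n |
      ((toMat y.fst)ᵀ * toMat y.fst).det ≠ 0 ∧ (toMat y.snd * (toMat y.snd)ᵀ).det ≠ 0} := by
    ext y
    simp only [fullRankPairs, Set.mem_ofPred_eq, rank_eq_width_iff_isUnit (toMat y.fst),
      rank_eq_height_iff_isUnit (toMat y.snd), isUnit_iff_ne_zero]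
  rw [h]
  have h1 := continuous_fst_toMat (m := m) (k := k) (n := n)
  have h2 := continuous_snd_toMat (m := m) (k := k) (n := n)
  exact (isOpen_ne_fun (h1.matrix_transpose.matrix_mul h1).matrix_det continuous_const).inter
    (isOpen_ne_fun (h2.matrix_mul h2.matrix_transpose).matrix_det continuous_const)

end Rank

/-! ### Derivative of the product map and its constant rank. -/

section Derivative

theorem hasDerivAt_zero_of_quadratic {F : Type*} [NormedAddCommGroup F] [NormedSpace ℝ F]
    {f : ℝ → F} {z l w : F} (h : ∀ t : ℝ, f t = z + t • l + t ^ 2 • w) : HasDerivAt f l 0 := by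
  rw [funext h]
  simpa using (((hasDerivAt_id (0 : ℝ)).smul_const l).const_add z).fun_add
    ((hasDerivAt_pow 2 (0 : ℝ)).smul_const w)

/-- Both `productMap` and `normalMap` are quadratic along the lines considered, so their derivatives
can be read off as linear coefficients. -/
theorem fderiv_apply_eq_of_quadratic {E F : Type*} [NormedAddCommGroup E] [NormedSpace ℝ E]
    [NormedAddCommGroup F] [NormedSpace ℝ F] {f : E → F} {y δ : E} {l w : F}
    (hf : DifferentiableAt ℝ f y) (h : ∀ t : ℝ, f (y + t • δ) = f y + t • l + t ^ 2 • w) :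
    fderiv ℝ f y δ = l := by
  have h1 : HasDerivAt (fun t : ℝ => f (y + t • δ)) (fderiv ℝ f y δ) 0 := by
    have hg : HasDerivAt (fun t : ℝ => y + t • δ) δ 0 := by
      simpa using ((hasDerivAt_id (0 : ℝ)).smul_const δ).const_add y
    have hf' : HasFDerivAt f (fderiv ℝ f y) (y + (0 : ℝ) • δ) := by simpa using hf.hasFDerivAt
    exact hf'.comp_hasDerivAt 0 hg
  exact h1.unique (hasDerivAt_zero_of_quadratic h)

open Matrix

variable {m k n : ℕ}

theorem productMap_add_smul (y δ : FactorSpace m k n) (t : ℝ) :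
    productMap m k n (y + t • δ) = productMap m k n y +
      t • ofMat (toMat δ.fst * toMat y.snd + toMat y.fst * toMat δ.snd) +
      t ^ 2 • ofMat (toMat δ.fst * toMat δ.snd) := by
  change ofMat ((toMat y.fst + t • toMat δ.fst) * (toMat y.snd + t • toMat δ.snd)) =
    ofMat (toMat y.fst * toMat y.snd +
      t • (toMat δ.fst * toMat y.snd + toMat y.fst * toMat δ.snd) +
      t ^ 2 • (toMat δ.fst * toMat δ.snd))
  congr 1
  simp only [Matrix.add_mul, Matrix.mul_add, Matrix.smul_mul, Matrix.mul_smul]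
  module

theorem fderiv_productMap_apply (y δ : FactorSpace m k n) :
    fderiv ℝ (productMap m k n) y δ =
      ofMat (toMat δ.fst * toMat y.snd + toMat y.fst * toMat δ.snd) :=
  fderiv_apply_eq_of_quadratic ((contDiff_productMap (N := 1)).differentiable (by simp) y)
    (productMap_add_smul y δ)

/-- The tangent vector at `y` of the orbit of `y` under `(L, R) ↦ (L C, C⁻¹ R)`. -/
def orbitTangent (y : FactorSpace m k n) : Matrix (Fin k) (Fin k) ℝ →ₗ[ℝ] FactorSpace m k n where
  toFun C := ofPair (toMat y.fst * C) (-(C * toMat y.snd))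
  map_add' C D := by
    rw [Matrix.mul_add, Matrix.add_mul, neg_add]; rfl
  map_smul' c C := by
    rw [Matrix.mul_smul, Matrix.smul_mul, ← smul_neg]; rfl

theorem range_orbitTangent {y : FactorSpace m k n} (hy : y ∈ fullRankPairs m k n) :
    LinearMap.range (orbitTangent y) =
      LinearMap.ker (fderiv ℝ (productMap m k n) y : FactorSpace m k n →ₗ[ℝ] MatSpace m n) := by
  ext δ
  simp only [LinearMap.mem_range, LinearMap.mem_ker, ContinuousLinearMap.coe_coe,
    fderiv_productMap_apply]
  constructor
  · rintro ⟨C, rfl⟩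
    change ofMat (toMat y.fst * C * toMat y.snd + toMat y.fst * -(C * toMat y.snd)) = ofMat 0
    rw [Matrix.mul_neg, Matrix.mul_assoc, add_neg_cancel]
  · intro h
    have h' : toMat δ.fst * toMat y.snd + toMat y.fst * toMat δ.snd = 0 :=
      ofMat_injective h
    have h1 : toMat δ.fst = toMat y.fst * -(toMat δ.snd * rightInv (toMat y.snd)) := by
      have := congrArg (· * rightInv (toMat y.snd)) h'
      simp only [Matrix.add_mul, Matrix.mul_assoc, mul_rightInv hy.2, Matrix.mul_one,
        Matrix.zero_mul] at this
      rw [Matrix.mul_neg]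
      exact eq_neg_of_add_eq_zero_left this
    -- If `a R + L b = 0`, a right inverse `R⁺` gives `a = L C` with `C = -b R⁺`; then `L b = -L C
    -- R`, and `L` cancels.
    refine ⟨-(toMat δ.snd * rightInv (toMat y.snd)), ?_⟩
    have h2 : -(-(toMat δ.snd * rightInv (toMat y.snd)) * toMat y.snd) = toMat δ.snd := by
      apply mul_left_cancel_of_rank hy.1
      rw [Matrix.mul_neg, ← Matrix.mul_assoc, ← h1]
      exact neg_eq_of_add_eq_zero_right h'
    change ofPair (toMat y.fst * -(toMat δ.snd * rightInv (toMat y.snd)))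
      (-(-(toMat δ.snd * rightInv (toMat y.snd)) * toMat y.snd)) = δ
    rw [h2, ← h1]; rfl

theorem orbitTangent_injective {y : FactorSpace m k n} (hy : y ∈ fullRankPairs m k n) :
    Function.Injective (orbitTangent y) := by
  intro C D h
  exact mul_left_cancel_of_rank hy.1 (congrArg (fun z : FactorSpace m k n => toMat z.fst) h)

/-- Rank–nullity: the kernel is the injective image of the `k × k` matrices under `orbitTangent`. -/
theorem finrank_range_fderiv_productMap {y : FactorSpace m k n} (hy : y ∈ fullRankPairs m k n) :
    Module.finrank ℝ (LinearMap.range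
      (fderiv ℝ (productMap m k n) y : FactorSpace m k n →ₗ[ℝ] MatSpace m n)) =
      m * k + k * n - k * k := by
  have h1 := LinearMap.finrank_range_add_finrank_ker
    (fderiv ℝ (productMap m k n) y : FactorSpace m k n →ₗ[ℝ] MatSpace m n)
  rw [← range_orbitTangent hy, LinearMap.finrank_range_of_inj (orbitTangent_injective hy),
    (WithLp.linearEquiv 2 ℝ (MatSpace m k × MatSpace k n)).finrank_eq] at h1
  simp [Module.finrank_matrix] at h1
  omega

theorem isConstantRankMap_productMap :
    IsConstantRankMap (productMap m k n) (fullRankPairs m k n) :=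
  ⟨isOpen_fullRankPairs, contDiff_productMap.contDiffOn, _,
    fun _ hy => finrank_range_fderiv_productMap hy⟩

end Derivative

/-! ### Singular value bounds and the extremal eigenmatrix. -/

section SingularValues

open Matrix Module

theorem mul_norm_sq_le_inner_of_eigenvalues {E : Type*} [NormedAddCommGroup E]
    [InnerProductSpace ℝ E] [FiniteDimensional ℝ E] {S : E →ₗ[ℝ] E} (hS : S.IsSymmetric) {d : ℕ}
    (hd : finrank ℝ E = d) {c : ℝ} (h : ∀ i, c ≤ hS.eigenvalues hd i) (z : E) :
    c * ‖z‖ ^ 2 ≤ inner ℝ (S z) z := by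
  set b := hS.eigenvectorBasis hd with hb
  have h1 : inner ℝ (S z) z = ∑ i, hS.eigenvalues hd i * inner ℝ (b i) z ^ 2 := by
    rw [← b.sum_inner_mul_inner (S z) z]
    refine Finset.sum_congr rfl fun i _ => ?_
    rw [hS z (b i), hb, hS.apply_eigenvectorBasis hd i, ← hb]
    simp only [RCLike.ofReal_real_eq_id, id, real_inner_smul_right, real_inner_comm z (b i)]
    ring
  have h2 : ‖z‖ ^ 2 = ∑ i, inner ℝ (b i) z ^ 2 := by
    rw [← b.sum_sq_norm_inner_right z]
    simp
  rw [h1, h2, Finset.mul_sum]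
  exact Finset.sum_le_sum fun i _ => mul_le_mul_of_nonneg_right (h i) (sq_nonneg _)

variable {p q r : ℕ}

theorem sigma_nonneg (A : Matrix (Fin p) (Fin q) ℝ) (i : ℕ) : 0 ≤ sigma A i :=
  LinearMap.singularValues_nonneg _ _

theorem finrank_range_toEuclideanLin (A : Matrix (Fin p) (Fin q) ℝ) :
    finrank ℝ (LinearMap.range (Matrix.toEuclideanLin A)) = A.rank := by
  rw [Matrix.toEuclideanLin_eq_toLin_orthonormal, ← Matrix.rank_eq_finrank_range_toLin]

theorem sigma_pos_iff (A : Matrix (Fin p) (Fin q) ℝ) (i : ℕ) :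
    0 < sigma A i ↔ i - 1 < A.rank := by
  rw [sigma, LinearMap.singularValues_pos_iff_lt_finrank_range, finrank_range_toEuclideanLin]

theorem adjoint_toEuclideanLin (A : Matrix (Fin p) (Fin q) ℝ) :
    LinearMap.adjoint (Matrix.toEuclideanLin A) = Matrix.toEuclideanLin Aᵀ := by
  rw [← Matrix.toEuclideanLin_conjTranspose_eq_adjoint, Matrix.conjTranspose_eq_transpose_of_trivial]

theorem norm_sq_toEuclideanLin (A : Matrix (Fin p) (Fin q) ℝ) (z : EuclideanSpace ℝ (Fin q)) :
    ‖Matrix.toEuclideanLin A z‖ ^ 2 =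
      inner ℝ ((LinearMap.adjoint (Matrix.toEuclideanLin A) ∘ₗ Matrix.toEuclideanLin A) z) z := by
  rw [LinearMap.comp_apply, LinearMap.adjoint_inner_left, real_inner_self_eq_norm_sq]

theorem sigma_width_mul_norm_le (A : Matrix (Fin p) (Fin q) ℝ) (z : EuclideanSpace ℝ (Fin q)) :
    sigma A q ^ 2 * ‖z‖ ^ 2 ≤ ‖Matrix.toEuclideanLin A z‖ ^ 2 := by
  rw [norm_sq_toEuclideanLin]
  refine mul_norm_sq_le_inner_of_eigenvalues
    (Matrix.toEuclideanLin A).isSymmetric_adjoint_comp_self (finrank_euclideanSpace_fin (n := q))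
    (fun i => ?_) z
  rw [← LinearMap.sq_singularValues_fin]
  exact pow_le_pow_left₀ (sigma_nonneg A q)
    ((Matrix.toEuclideanLin A).singularValues_antitone (Nat.le_sub_one_of_lt i.2)) 2

/-- `sigma` comes from `Aᵀ A`, but the bound concerns `A Aᵀ`. Full row rank makes every eigenvalue
of `A Aᵀ` positive, and `u ↦ Aᵀ u` carries its eigenvectors to eigenvectors of `Aᵀ A` with the same
eigenvalue. -/
theorem sigma_height_mul_norm_le {A : Matrix (Fin p) (Fin q) ℝ} (hA : A.rank = p)
    (z : EuclideanSpace ℝ (Fin p)) :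
    sigma A p ^ 2 * ‖z‖ ^ 2 ≤ ‖Matrix.toEuclideanLin Aᵀ z‖ ^ 2 := by
  set T := Matrix.toEuclideanLin A with hT
  rw [norm_sq_toEuclideanLin]
  refine mul_norm_sq_le_inner_of_eigenvalues
    (Matrix.toEuclideanLin Aᵀ).isSymmetric_adjoint_comp_self (finrank_euclideanSpace_fin (n := p))
    (fun i => ?_) z
  set ev := (Matrix.toEuclideanLin Aᵀ).isSymmetric_adjoint_comp_self.eigenvalues
    (finrank_euclideanSpace_fin (n := p)) i with hev
  obtain ⟨u, hu⟩ := (LinearMap.IsSymmetric.hasEigenvalue_eigenvalues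
    (Matrix.toEuclideanLin Aᵀ).isSymmetric_adjoint_comp_self
    (finrank_euclideanSpace_fin (n := p)) i).exists_hasEigenvector
  rw [← hev] at hu
  have hu1 : T (LinearMap.adjoint T u) = ev • u := by
    have := hu.apply_eq_smul
    rw [← adjoint_toEuclideanLin, LinearMap.adjoint_adjoint] at this
    exact this
  have hrk : finrank ℝ (LinearMap.range (LinearMap.adjoint T)) = p := by
    rw [hT, adjoint_toEuclideanLin, finrank_range_toEuclideanLin, Matrix.rank_transpose, hA]
  have hinj : Function.Injective (LinearMap.adjoint T) := by
    rw [← LinearMap.ker_eq_bot, ← Submodule.finrank_eq_zero]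
    have := LinearMap.finrank_range_add_finrank_ker (LinearMap.adjoint T)
    rw [hrk, finrank_euclideanSpace_fin] at this
    omega
  have hw : LinearMap.adjoint T u ≠ 0 := by
    rw [Ne, LinearMap.map_eq_zero_iff _ hinj]
    exact hu.2
  have hpos : 0 < ev := by
    have h1 : ev * ‖u‖ ^ 2 = ‖LinearMap.adjoint T u‖ ^ 2 := by
      rw [← real_inner_self_eq_norm_sq, ← real_inner_self_eq_norm_sq, LinearMap.adjoint_inner_left,
        hu1, real_inner_smul_right]
    have h2 : 0 < ‖u‖ ^ 2 := by have := norm_pos_iff.2 hu.2; positivity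
    have h3 : 0 < ‖LinearMap.adjoint T u‖ ^ 2 := by have := norm_pos_iff.2 hw; positivity
    exact pos_of_mul_pos_left (h1 ▸ h3) h2.le
  have hE : End.HasEigenvalue (LinearMap.adjoint T ∘ₗ T) ev := by
    refine End.hasEigenvalue_of_hasEigenvector (x := LinearMap.adjoint T u)
      ⟨End.mem_eigenspace_iff.2 ?_, hw⟩
    rw [LinearMap.comp_apply, hu1, map_smul]
  obtain ⟨j, hj⟩ := T.isSymmetric_adjoint_comp_self.exists_eigenvalues_eq
    (finrank_euclideanSpace_fin (n := q)) hE
  have hj' : T.singularValues j ^ 2 = ev := by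
    rw [LinearMap.sq_singularValues_fin]
    exact hj
  -- A positive singular value has zero-based index below the rank `p`, hence is at least `sigma A
  -- p`.
  have hjp : (j : ℕ) < p := by
    have : 0 < T.singularValues j := by
      rw [LinearMap.singularValues_pos_iff_ne_zero]
      rintro h0
      rw [h0] at hj'
      simp at hj'
      exact hpos.ne hj'
    rwa [LinearMap.singularValues_pos_iff_lt_finrank_range, hT, finrank_range_toEuclideanLin,
      hA] at this
  rw [← hj']
  exact pow_le_pow_left₀ (sigma_nonneg A p)
    (T.singularValues_antitone (Nat.le_sub_one_of_lt hjp)) 2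

theorem exists_transpose_mul_self_eigenvector (A : Matrix (Fin p) (Fin q) ℝ) {i : ℕ} (hi : 1 ≤ i)
    (hiq : i ≤ q) : ∃ w : Fin q → ℝ, w ≠ 0 ∧ (Aᵀ * A) *ᵥ w = sigma A i ^ 2 • w := by
  obtain ⟨w, hw⟩ := ((Matrix.toEuclideanLin A).hasEigenvalue_adjoint_comp_self_sq_singularValues
    (n := i - 1) (by rw [finrank_euclideanSpace_fin]; omega)).exists_hasEigenvector
  have h1 := hw.apply_eq_smul
  rw [adjoint_toEuclideanLin, LinearMap.comp_apply] at h1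
  refine ⟨w.ofLp, fun h => hw.2 ((WithLp.ofLp_eq_zero 2).1 h), ?_⟩
  have h2 := congrArg WithLp.ofLp h1
  simpa [Matrix.mulVec_mulVec, sigma] using h2

theorem exists_mul_transpose_self_eigenvector (A : Matrix (Fin p) (Fin q) ℝ) {i : ℕ} (hi : 1 ≤ i)
    (hip : i ≤ p) : ∃ u : Fin p → ℝ, u ≠ 0 ∧ (A * Aᵀ) *ᵥ u = sigma A i ^ 2 • u := by
  -- If the singular value is 0, then `A Aᵀ` is singular and a kernel vector serves; otherwise push
  -- an eigenvector `w` of `Aᵀ A` forward to `A w ≠ 0`.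
  rcases (sigma_nonneg A i).eq_or_lt with h0 | hpos
  · have hr : A.rank < p := by
      have : ¬ 0 < sigma A i := h0 ▸ lt_irrefl _
      rw [sigma_pos_iff] at this
      omega
    have hdet : (A * Aᵀ).det = 0 := by
      by_contra hne
      have := Matrix.rank_of_det_ne_zero hne
      rw [Matrix.rank_self_mul_transpose, Fintype.card_fin] at this
      omega
    obtain ⟨u, hu, hu0⟩ := Matrix.exists_mulVec_eq_zero_iff.2 hdet
    exact ⟨u, hu, by rw [hu0, ← h0]; simp⟩
  · have hiq : i ≤ q := by
      have := (sigma_pos_iff A i).1 hpos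
      have h2 := A.rank_le_width
      omega
    obtain ⟨w, hw, h⟩ := exists_transpose_mul_self_eigenvector A hi hiq
    refine ⟨A *ᵥ w, fun hAw => hw ?_, ?_⟩
    · rw [← Matrix.mulVec_mulVec, hAw, Matrix.mulVec_zero] at h
      exact (smul_eq_zero.1 h.symm).resolve_left (by positivity)
    · rw [Matrix.mulVec_mulVec, Matrix.mul_assoc, ← Matrix.mulVec_mulVec, h, Matrix.mulVec_smul]

attribute [local instance] Matrix.frobeniusNormedAddCommGroup Matrix.frobeniusNormedSpace

theorem frobenius_norm_sq_eq_sum_col (X : Matrix (Fin p) (Fin q) ℝ) :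
    ‖X‖ ^ 2 = ∑ j, ‖WithLp.toLp 2 (X.col j)‖ ^ 2 := by
  rw [← norm_ofMat, EuclideanSpace.norm_sq_eq, Fintype.sum_prod_type, Finset.sum_comm]
  simp [EuclideanSpace.norm_sq_eq, ofMat]

/-- The squared Frobenius norm is the sum over columns, so a bound on vectors passes to matrices. -/
theorem mul_frobenius_norm_sq_le {A : Matrix (Fin p) (Fin q) ℝ} {c : ℝ}
    (h : ∀ z, c * ‖z‖ ^ 2 ≤ ‖Matrix.toEuclideanLin A z‖ ^ 2) (X : Matrix (Fin q) (Fin r) ℝ) :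
    c * ‖X‖ ^ 2 ≤ ‖A * X‖ ^ 2 := by
  rw [frobenius_norm_sq_eq_sum_col, frobenius_norm_sq_eq_sum_col, Finset.mul_sum]
  refine Finset.sum_le_sum fun j _ => (h _).trans_eq ?_
  congr 2

theorem sigma_width_mul_frobenius_norm_le (A : Matrix (Fin p) (Fin q) ℝ)
    (X : Matrix (Fin q) (Fin r) ℝ) : sigma A q ^ 2 * ‖X‖ ^ 2 ≤ ‖A * X‖ ^ 2 :=
  mul_frobenius_norm_sq_le (sigma_width_mul_norm_le A) X

theorem sigma_height_mul_frobenius_norm_le {A : Matrix (Fin p) (Fin q) ℝ} (hA : A.rank = p)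
    (X : Matrix (Fin p) (Fin r) ℝ) : sigma A p ^ 2 * ‖X‖ ^ 2 ≤ ‖Aᵀ * X‖ ^ 2 :=
  mul_frobenius_norm_sq_le (sigma_height_mul_norm_le hA) X

/-- The square of the smallest nonzero singular value of the derivative of `(L, R) ↦ L R`. -/
def minSq {m k n : ℕ} (L : Matrix (Fin m) (Fin k) ℝ) (R : Matrix (Fin k) (Fin n) ℝ) : ℝ :=
  min (sigma L k ^ 2 + sigma R n ^ 2) (sigma L m ^ 2 + sigma R k ^ 2)

variable {m k n : ℕ} {L : Matrix (Fin m) (Fin k) ℝ} {R : Matrix (Fin k) (Fin n) ℝ}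

theorem minSq_pos (hk : 1 ≤ k) (hL : L.rank = k) (hR : R.rank = k) : 0 < minSq L R := by
  have h1 : 0 < sigma L k := (sigma_pos_iff L k).2 (by omega)
  have h2 : 0 < sigma R k := (sigma_pos_iff R k).2 (by omega)
  exact lt_min (by positivity) (by positivity)

theorem minSq_mul_le (hk : 1 ≤ k) (hL : L.rank = k) (hR : R.rank = k)
    (a : Matrix (Fin m) (Fin k) ℝ) (b : Matrix (Fin k) (Fin n) ℝ) :
    minSq L R * (‖a‖ ^ 2 + ‖b‖ ^ 2) ≤
      ‖a * R‖ ^ 2 + ‖L * b‖ ^ 2 + ‖Lᵀ * a‖ ^ 2 + ‖b * Rᵀ‖ ^ 2 := by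
  have h1 : sigma R k ^ 2 * ‖a‖ ^ 2 ≤ ‖a * R‖ ^ 2 := by
    simpa [← Matrix.transpose_mul, Matrix.frobenius_norm_transpose]
      using sigma_height_mul_frobenius_norm_le hR aᵀ
  have h2 : sigma L k ^ 2 * ‖b‖ ^ 2 ≤ ‖L * b‖ ^ 2 := sigma_width_mul_frobenius_norm_le L b
  have h3 : sigma R n ^ 2 * ‖b‖ ^ 2 ≤ ‖b * Rᵀ‖ ^ 2 := by
    have := sigma_width_mul_frobenius_norm_le R bᵀ
    rwa [← Matrix.frobenius_norm_transpose (R * bᵀ), Matrix.transpose_mul,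
      Matrix.transpose_transpose, Matrix.frobenius_norm_transpose] at this
  -- The height bound needs full row rank, that is `m = k`; for `m > k` the singular value is 0.
  have h4 : sigma L m ^ 2 * ‖a‖ ^ 2 ≤ ‖Lᵀ * a‖ ^ 2 := by
    rcases eq_or_ne m k with rfl | hmk
    · exact sigma_height_mul_frobenius_norm_le hL a
    · have hkm : k ≤ m := hL ▸ L.rank_le_height
      have : sigma L m = 0 := by
        refine le_antisymm (not_lt.1 ?_) (sigma_nonneg L m)
        rw [sigma_pos_iff]; omega
      rw [this]; simp
  have h5 : minSq L R * ‖a‖ ^ 2 ≤ (sigma L m ^ 2 + sigma R k ^ 2) * ‖a‖ ^ 2 :=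
    mul_le_mul_of_nonneg_right (min_le_right _ _) (sq_nonneg _)
  have h6 : minSq L R * ‖b‖ ^ 2 ≤ (sigma L k ^ 2 + sigma R n ^ 2) * ‖b‖ ^ 2 :=
    mul_le_mul_of_nonneg_right (min_le_left _ _) (sq_nonneg _)
  linarith

/-- The value `minSq L R` is an eigenvalue of `X ↦ L Lᵀ X + X Rᵀ R`, with an eigenvector of rank
one. -/
theorem exists_eigenmatrix (hk : 1 ≤ k) (hL : L.rank = k) (hR : R.rank = k) :
    ∃ X : Matrix (Fin m) (Fin n) ℝ, X ≠ 0 ∧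
      X * Rᵀ * R + L * (Lᵀ * X) = minSq L R • X := by
  have hkm : k ≤ m := hL ▸ L.rank_le_height
  have hkn : k ≤ n := hR ▸ R.rank_le_width
  have key : ∀ i j, 1 ≤ i → i ≤ m → 1 ≤ j → j ≤ n → ∃ X : Matrix (Fin m) (Fin n) ℝ, X ≠ 0 ∧
      X * Rᵀ * R + L * (Lᵀ * X) = (sigma L i ^ 2 + sigma R j ^ 2) • X := by
    intro i j hi him hj hjn
    obtain ⟨u, hu, hu'⟩ := exists_mul_transpose_self_eigenvector L hi him
    obtain ⟨w, hw, hw'⟩ := exists_transpose_mul_self_eigenvector R hj hjn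
    -- On `u wᵀ`, with `u` an eigenvector of `L Lᵀ` and `w` of `Rᵀ R`, the two eigenvalues add.
    refine ⟨vecMulVec u w, ?_, ?_⟩
    · obtain ⟨a, ha⟩ := Function.ne_iff.1 hu
      obtain ⟨b, hb⟩ := Function.ne_iff.1 hw
      intro h
      have := congrFun (congrFun h a) b
      exact mul_ne_zero ha hb this
    · rw [Matrix.mul_assoc, ← Matrix.mul_assoc L, Matrix.vecMulVec_mul, Matrix.mul_vecMulVec, hu',
        ← Matrix.mulVec_transpose, Matrix.transpose_mul, Matrix.transpose_transpose, hw',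
        Matrix.vecMulVec_smul, Matrix.smul_vecMulVec, add_smul, add_comm]
  rcases min_choice (sigma L k ^ 2 + sigma R n ^ 2) (sigma L m ^ 2 + sigma R k ^ 2) with h | h
  · rw [minSq, h]; exact key k n hk hkm (by omega) le_rfl
  · rw [minSq, h]; exact key m k (by omega) le_rfl hk hkn

end SingularValues

/-! ### The image of the product map as an embedded submanifold. -/

section Embedded

open Matrix

variable {m k n : ℕ}

/-- A product of matrices with inner dimension `k` is determined by its rows and columns seen
through `P` and `Q`, if the corresponding `k × k` matrix is invertible. -/
theorem mul_eq_mul_inv_mul (A : Matrix (Fin m) (Fin k) ℝ) (B : Matrix (Fin k) (Fin n) ℝ)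
    {P : Matrix (Fin k) (Fin m) ℝ} {Q : Matrix (Fin n) (Fin k) ℝ}
    (h : IsUnit (P * (A * B) * Q).det) :
    A * B * Q * (P * (A * B) * Q)⁻¹ * (P * (A * B)) = A * B := by
  have h1 : P * (A * B) * Q = P * A * (B * Q) := by simp only [Matrix.mul_assoc]
  -- The matrix splits as `(P A) (B Q)` with square factors, so both are invertible.
  rw [h1, Matrix.det_mul, IsUnit.mul_iff] at h
  rw [h1, Matrix.mul_inv_rev]
  calc A * B * Q * ((B * Q)⁻¹ * (P * A)⁻¹) * (P * (A * B))
      = A * ((B * Q) * (B * Q)⁻¹) * ((P * A)⁻¹ * (P * A)) * B := by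
        simp only [Matrix.mul_assoc]
    _ = A * B := by
        rw [Matrix.mul_nonsing_inv _ h.2, Matrix.nonsing_inv_mul _ h.1, Matrix.mul_one,
          Matrix.mul_one]

variable (P : Matrix (Fin k) (Fin m) ℝ) (Q : Matrix (Fin n) (Fin k) ℝ)

/-- A factorisation of `X`, valid where `X` has rank `k` and `P X Q` is invertible. -/
def factorSection (X : Matrix (Fin m) (Fin n) ℝ) : FactorSpace m k n :=
  ofPair (X * Q) ((P * X * Q)⁻¹ * (P * X))

/-- The matrix `X Q (P X Q)⁻¹ P X`, which has rank `k`. -/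
def rankRetract (X : Matrix (Fin m) (Fin n) ℝ) : Matrix (Fin m) (Fin n) ℝ :=
  X * Q * (P * X * Q)⁻¹ * (P * X)

theorem productMap_factorSection (X : Matrix (Fin m) (Fin n) ℝ) :
    productMap m k n (factorSection P Q X) = ofMat (rankRetract P Q X) := by
  rw [rankRetract, Matrix.mul_assoc _ _ (P * X)]; rfl

variable {P Q}

/-- Only `P X` and `X Q` enter. Hence a shear that preserves them leaves these maps unchanged. -/
theorem factorSection_congr {X Y : Matrix (Fin m) (Fin n) ℝ} (h1 : P * X = P * Y)
    (h2 : X * Q = Y * Q) : factorSection P Q X = factorSection P Q Y := by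
  rw [factorSection, factorSection, h1, h2]

theorem rankRetract_congr {X Y : Matrix (Fin m) (Fin n) ℝ} (h1 : P * X = P * Y)
    (h2 : X * Q = Y * Q) : rankRetract P Q X = rankRetract P Q Y := by
  rw [rankRetract, rankRetract, h1, h2]

theorem rankRetract_mul {A : Matrix (Fin m) (Fin k) ℝ} {B : Matrix (Fin k) (Fin n) ℝ}
    (h : IsUnit (P * (A * B) * Q).det) : rankRetract P Q (A * B) = A * B :=
  mul_eq_mul_inv_mul A B h

theorem mul_rankRetract {X : Matrix (Fin m) (Fin n) ℝ} (h : IsUnit (P * X * Q).det) :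
    P * rankRetract P Q X = P * X := by
  have : P * rankRetract P Q X = P * X * Q * (P * X * Q)⁻¹ * (P * X) := by
    simp only [rankRetract, Matrix.mul_assoc]
  rw [this, Matrix.mul_nonsing_inv _ h, Matrix.one_mul]

theorem rankRetract_mul_right {X : Matrix (Fin m) (Fin n) ℝ} (h : IsUnit (P * X * Q).det) :
    rankRetract P Q X * Q = X * Q := by
  have : rankRetract P Q X * Q = X * Q * ((P * X * Q)⁻¹ * (P * X * Q)) := by
    simp only [rankRetract, Matrix.mul_assoc]
  rw [this, Matrix.nonsing_inv_mul _ h, Matrix.mul_one]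

section

attribute [local instance] Matrix.frobeniusNormedAddCommGroup Matrix.frobeniusNormedSpace

variable {N : WithTop ℕ∞}

theorem isOpen_isUnit_det (P : Matrix (Fin k) (Fin m) ℝ) (Q : Matrix (Fin n) (Fin k) ℝ) :
    IsOpen {x : MatSpace m n | IsUnit (P * toMat x * Q).det} := by
  have h := (contDiff_toMat (p := m) (q := n) (N := 0)).continuous
  have : Continuous fun x : MatSpace m n => (P * toMat x * Q).det :=
    ((continuous_const.matrix_mul h).matrix_mul continuous_const).matrix_det
  simpa only [isUnit_iff_ne_zero] using isOpen_ne_fun this continuous_const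

theorem contDiffAt_mul_inv_mul {x : MatSpace m n} (h : IsUnit (P * toMat x * Q).det) :
    ContDiffAt ℝ N (fun x : MatSpace m n => (P * toMat x * Q)⁻¹ * (P * toMat x)) x :=
  have h1 : ContDiff ℝ N fun x : MatSpace m n => P * toMat x :=
    contDiff_const.matrix_mul contDiff_toMat
  ((h1.matrix_mul contDiff_const).contDiffAt.matrix_inv h).matrix_mul h1.contDiffAt

theorem contDiffAt_factorSection {x : MatSpace m n} (h : IsUnit (P * toMat x * Q).det) :
    ContDiffAt ℝ N (fun x : MatSpace m n => factorSection P Q (toMat x)) x :=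
  contDiff_ofPair.contDiffAt.comp x
    ((contDiff_toMat.matrix_mul contDiff_const).contDiffAt.prodMk (contDiffAt_mul_inv_mul h))

theorem contDiffAt_rankRetract {x : MatSpace m n} (h : IsUnit (P * toMat x * Q).det) :
    ContDiffAt ℝ N (fun x : MatSpace m n => rankRetract P Q (toMat x)) x := by
  have : (fun x : MatSpace m n => rankRetract P Q (toMat x)) =
      fun x => toMat x * Q * ((P * toMat x * Q)⁻¹ * (P * toMat x)) := by
    funext x; rw [rankRetract, Matrix.mul_assoc _ _ (P * toMat x)]
  rw [this]
  exact (contDiff_toMat.matrix_mul contDiff_const).contDiffAt.matrix_mul (contDiffAt_mul_inv_mul h)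

/-- The chart is the shear `X ↦ X - c X`, where `c X` is the part of `rankRetract P Q X` transverse
to the tangent space at `L R`. Since `c X` is annihilated by `P` on the left and `Q` on the right,
the shear preserves `P X` and `X Q`, hence `c`, and its inverse is `X ↦ X + c X`. Near `L R`, `X`
lies in the image exactly when it equals its retract, i.e. when the sheared point is tangent. -/
theorem isEmbeddedSubmanifold_productMap_image {W : Set (FactorSpace m k n)} (hW : IsOpen W)
    (hWr : W ⊆ fullRankPairs m k n) : IsEmbeddedSubmanifold (productMap m k n '' W) := by
  refine ⟨m * k + k * n - k * k, ?_⟩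
  rintro _ ⟨y, hy, rfl⟩
  set L := toMat y.fst with hL
  set R := toMat y.snd with hR
  set P := leftInv L with hP
  set Q := rightInv R with hQ
  have hPL : P * L = 1 := leftInv_mul (hWr hy).1
  have hRQ : R * Q = 1 := mul_rightInv (hWr hy).2
  have hPK : P * (1 - L * P) = 0 := by
    rw [Matrix.mul_sub, ← Matrix.mul_assoc, hPL, Matrix.one_mul, Matrix.mul_one, sub_self]
  have hKQ : (1 - Q * R) * Q = 0 := by
    rw [Matrix.sub_mul, Matrix.mul_assoc, hRQ, Matrix.one_mul, Matrix.mul_one, sub_self]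
  have hKK : (1 - L * P) * (1 - L * P) = 1 - L * P := by
    rw [Matrix.sub_mul, Matrix.mul_assoc L, hPK, Matrix.mul_zero, sub_zero, Matrix.one_mul]
  have hKK' : (1 - Q * R) * (1 - Q * R) = 1 - Q * R := by
    rw [Matrix.mul_sub, ← Matrix.mul_assoc, hKQ, Matrix.zero_mul, sub_zero, Matrix.mul_one]
  set c : Matrix (Fin m) (Fin n) ℝ → Matrix (Fin m) (Fin n) ℝ :=
    fun X => (1 - L * P) * rankRetract P Q X * (1 - Q * R) with hc
  have hPc : ∀ X, P * c X = 0 := fun X => by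
    rw [hc]; simp only [← Matrix.mul_assoc]; rw [hPK]; simp
  have hcQ : ∀ X, c X * Q = 0 := fun X => by
    rw [hc]; simp only [Matrix.mul_assoc]; rw [hKQ]; simp
  have hPm : ∀ X, P * (X - c X) = P * X := fun X => by rw [Matrix.mul_sub, hPc, sub_zero]
  have hQm : ∀ X, (X - c X) * Q = X * Q := fun X => by rw [Matrix.sub_mul, hcQ, sub_zero]
  have hPp : ∀ X, P * (X + c X) = P * X := fun X => by rw [Matrix.mul_add, hPc, add_zero]
  have hQp : ∀ X, (X + c X) * Q = X * Q := fun X => by rw [Matrix.add_mul, hcQ, add_zero]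
  have hcm : ∀ X, c (X - c X) = c X := fun X => by
    simp only [hc]; rw [rankRetract_congr (hPm X) (hQm X)]
  have hcp : ∀ X, c (X + c X) = c X := fun X => by
    simp only [hc]; rw [rankRetract_congr (hPp X) (hQp X)]
  set O : Set (MatSpace m n) := {x | IsUnit (P * toMat x * Q).det} with hO
  have hOo : IsOpen O := isOpen_isUnit_det P Q
  set s : MatSpace m n → FactorSpace m k n := fun x => factorSection P Q (toMat x) with hs
  -- Requiring the explicit factorisation to lie in `W` makes the chart describe the image of `W`,
  -- not just the set of all products.
  have hOW : IsOpen (O ∩ s ⁻¹' W) := by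
    refine ContinuousOn.isOpen_inter_preimage (fun x hx => ?_) hOo hW
    exact (contDiffAt_factorSection (N := 0) hx).continuousAt.continuousWithinAt
  have hmem : ∀ x x' : MatSpace m n, P * toMat x' = P * toMat x → toMat x' * Q = toMat x * Q →
      x ∈ O ∩ s ⁻¹' W → x' ∈ O ∩ s ⁻¹' W := by
    rintro x x' h1 h2 ⟨h3, h4⟩
    refine ⟨?_, ?_⟩
    · change IsUnit (P * toMat x' * Q).det
      rw [h1]; exact h3
    · change factorSection P Q (toMat x') ∈ W
      rw [factorSection_congr h1 h2]; exact h4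
  have hcs : ∀ x ∈ O, ContDiffAt ℝ ∞ (fun x : MatSpace m n => ofMat (c (toMat x))) x :=
    fun x hx => contDiff_ofMat.contDiffAt.comp x
      ((contDiffAt_const.matrix_mul (contDiffAt_rankRetract hx)).matrix_mul contDiffAt_const)
  have hsm : ∀ x ∈ O, ContDiffAt ℝ ∞ (fun x : MatSpace m n => x - ofMat (c (toMat x))) x :=
    fun x hx => contDiffAt_id.sub (hcs x hx)
  have hsp : ∀ x ∈ O, ContDiffAt ℝ ∞ (fun x : MatSpace m n => x + ofMat (c (toMat x))) x :=
    fun x hx => contDiffAt_id.add (hcs x hx)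
  let φ : OpenPartialHomeomorph (MatSpace m n) (MatSpace m n) :=
    { toFun := fun x => x - ofMat (c (toMat x))
      invFun := fun x => x + ofMat (c (toMat x))
      source := O ∩ s ⁻¹' W
      target := O ∩ s ⁻¹' W
      map_source' := fun x hx => hmem x _ (hPm _) (hQm _) hx
      map_target' := fun x hx => hmem x _ (hPp _) (hQp _) hx
      left_inv' := fun x _ => by
        change x - ofMat (c (toMat x)) + ofMat (c (toMat x - c (toMat x))) = x
        rw [hcm, sub_add_cancel]
      right_inv' := fun x _ => by
        change x + ofMat (c (toMat x)) - ofMat (c (toMat x + c (toMat x))) = x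
        rw [hcp, add_sub_cancel_right]
      open_source := hOW
      open_target := hOW
      continuousOn_toFun := fun x hx => (hsm x hx.1).continuousAt.continuousWithinAt
      continuousOn_invFun := fun x hx => (hsp x hx.1).continuousAt.continuousWithinAt }
  have hPG : P * (L * R) * Q = 1 := by
    rw [← Matrix.mul_assoc, hPL, Matrix.one_mul, hRQ]
  refine ⟨φ, LinearMap.range
    (fderiv ℝ (productMap m k n) y : FactorSpace m k n →ₗ[ℝ] MatSpace m n), ⟨?_, ?_⟩,
    fun x hx => (hsm x hx.1).contDiffWithinAt, fun x hx => (hsp x hx.1).contDiffWithinAt,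
    inferInstance, finrank_range_fderiv_productMap (hWr hy), ?_⟩
  · change IsUnit (P * (L * R) * Q).det
    rw [hPG, Matrix.det_one]; exact isUnit_one
  · change factorSection P Q (L * R) ∈ W
    rw [factorSection, hPG, inv_one, Matrix.one_mul, Matrix.mul_assoc, hRQ, Matrix.mul_one,
      ← Matrix.mul_assoc, hPL, Matrix.one_mul]
    exact hy
  have hV : ∀ w : MatSpace m n, w ∈ LinearMap.range
      (fderiv ℝ (productMap m k n) y : FactorSpace m k n →ₗ[ℝ] MatSpace m n) ↔
      (1 - L * P) * toMat w * (1 - Q * R) = 0 := by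
    intro w
    constructor
    · rintro ⟨δ, rfl⟩
      rw [ContinuousLinearMap.coe_coe, fderiv_productMap_apply, toMat_ofMat, ← hL, ← hR]
      have h1 : (1 - L * P) * L = 0 := by
        rw [Matrix.sub_mul, Matrix.mul_assoc, hPL, Matrix.one_mul, Matrix.mul_one, sub_self]
      have h2 : R * (1 - Q * R) = 0 := by
        rw [Matrix.mul_sub, ← Matrix.mul_assoc, hRQ, Matrix.one_mul, Matrix.mul_one, sub_self]
      rw [Matrix.mul_add, Matrix.add_mul, ← Matrix.mul_assoc _ L, h1, Matrix.zero_mul,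
        Matrix.zero_mul, Matrix.mul_assoc, Matrix.mul_assoc, h2, Matrix.mul_zero, Matrix.mul_zero,
        add_zero]
    · intro h
      refine ⟨ofPair ((1 - L * P) * toMat w * Q) (P * toMat w), ?_⟩
      rw [ContinuousLinearMap.coe_coe, fderiv_productMap_apply]
      change ofMat ((1 - L * P) * toMat w * Q * R + L * (P * toMat w)) = ofMat (toMat w)
      congr 1
      rw [Matrix.mul_sub, Matrix.mul_one, sub_eq_zero, ← Matrix.mul_assoc] at h
      rw [← h, Matrix.sub_mul, Matrix.one_mul, Matrix.mul_assoc, sub_add_cancel]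
  intro x hx
  have hPx : IsUnit (P * toMat x * Q).det := hx.1
  rw [hV]
  change _ ↔ (1 - L * P) * (toMat x - c (toMat x)) * (1 - Q * R) = 0
  have h1 : (1 - L * P) * (toMat x - c (toMat x)) * (1 - Q * R) =
      (1 - L * P) * (toMat x - rankRetract P Q (toMat x)) * (1 - Q * R) := by
    have : (1 - L * P) * c (toMat x) * (1 - Q * R) = c (toMat x) := by
      simp only [hc]
      calc _ = ((1 - L * P) * (1 - L * P)) * rankRetract P Q (toMat x) *
            ((1 - Q * R) * (1 - Q * R)) := by simp only [Matrix.mul_assoc]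
        _ = _ := by rw [hKK, hKK']
    rw [Matrix.mul_sub (1 - L * P) (toMat x), Matrix.sub_mul ((1 - L * P) * toMat x), this,
      Matrix.mul_sub (1 - L * P) (toMat x), Matrix.sub_mul ((1 - L * P) * toMat x)]
  -- `X` and its retract agree after multiplication by `P` or by `Q`, so both projections fix their
  -- difference.
  have h2 : (1 - L * P) * (toMat x - rankRetract P Q (toMat x)) * (1 - Q * R) =
      toMat x - rankRetract P Q (toMat x) := by
    rw [Matrix.sub_mul 1, Matrix.mul_assoc L, Matrix.mul_sub P, mul_rankRetract hPx, sub_self,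
      Matrix.mul_zero, sub_zero, Matrix.one_mul, Matrix.mul_sub _ 1, ← Matrix.mul_assoc _ Q,
      Matrix.sub_mul _ _ Q, rankRetract_mul_right hPx, sub_self, Matrix.zero_mul, sub_zero,
      Matrix.mul_one]
  rw [h1, h2, sub_eq_zero]
  constructor
  · rintro ⟨z, -, rfl⟩
    exact (rankRetract_mul hPx).symm
  · intro h
    refine ⟨s x, hx.2, ?_⟩
    rw [hs, productMap_factorSection, ← h]; rfl

end

end Embedded

/-! ### A smooth local inverse on an open set. -/

section LocalInverse

theorem exists_smooth_local_rightInverse {E : Type*} [NormedAddCommGroup E] [NormedSpace ℝ E]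
    [FiniteDimensional ℝ E] {f : E → E} {y : E} (hf : ContDiffAt ℝ ω f y)
    (hinj : Function.Injective (fderiv ℝ f y)) :
    ∃ (T : Set E) (g : E → E), IsOpen T ∧ f y ∈ T ∧ ContDiffOn ℝ ∞ g T ∧ g (f y) = y ∧
      ∀ t ∈ T, f (g t) = t := by
  have : CompleteSpace E := FiniteDimensional.complete ℝ E
  let e : E ≃L[ℝ] E := (LinearEquiv.ofInjectiveEndo
    (fderiv ℝ f y : E →ₗ[ℝ] E) hinj).toContinuousLinearEquiv
  have he : (e : E →L[ℝ] E) = fderiv ℝ f y := by ext z; rfl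
  have hω : (ω : WithTop ℕ∞) ≠ 0 := by simp
  have hf' : HasFDerivAt f (e : E →L[ℝ] E) y := by
    rw [he]; exact (hf.differentiableAt hω).hasFDerivAt
  set Φ := hf.toOpenPartialHomeomorph f hf' hω with hΦ
  have hy : y ∈ Φ.source := hf.mem_toOpenPartialHomeomorph_source hf' hω
  have hfy : f y ∈ Φ.target := hf.image_mem_toOpenPartialHomeomorph_target hf' hω
  have hsy : Φ.symm (f y) = y := Φ.left_inv hy
  have hsm : ContDiffAt ℝ ω Φ.symm (f y) := by
    refine Φ.contDiffAt_symm hfy (f₀' := e) ?_ ?_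
    · rw [hsy]; exact hf'
    · rw [hsy]; exact hf
  -- Analyticity at a point spreads to a neighbourhood, whereas `C^∞` at a point need not; this is
  -- why `ω` is assumed.
  obtain ⟨T, hT, hTo, hyT⟩ := mem_nhds_iff.1 (hsm.eventually (by simp))
  refine ⟨T ∩ Φ.target, Φ.symm, hTo.inter Φ.open_target, ⟨hyT, hfy⟩, fun t ht => ?_, hsy,
    fun t ht => Φ.right_inv ht.2⟩
  have h : ContDiffAt ℝ ω Φ.symm t := hT ht.1
  exact (h.of_le le_top).contDiffWithinAt

end LocalInverse

/-! ### Normality to the fibre, and minimality from a small multiplier. -/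

section Balance

open Matrix

attribute [local instance] Matrix.frobeniusNormedAddCommGroup Matrix.frobeniusNormedSpace

variable {m k n : ℕ} (L : Matrix (Fin m) (Fin k) ℝ) (R : Matrix (Fin k) (Fin n) ℝ)

/-- Vanishes exactly if the displacement `y - (L, R)` is orthogonal to the fibre of
`(L, R) ↦ L R` through `y`. -/
def balance (y : FactorSpace m k n) : Matrix (Fin k) (Fin k) ℝ :=
  (toMat y.fst)ᵀ * (toMat y.fst - L) - (toMat y.snd - R) * (toMat y.snd)ᵀ

/-- The adjoint at `(L, R)` of the derivative of the product map. -/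
def adjointTangent (X : Matrix (Fin m) (Fin n) ℝ) : FactorSpace m k n :=
  ofPair (X * Rᵀ) (Lᵀ * X)

/-- The map whose local inverse solves the least-squares problem. -/
def normalMap (y : FactorSpace m k n) : FactorSpace m k n :=
  ofPair (toMat y.fst * toMat y.snd * Rᵀ + L * balance L R y)
    (Lᵀ * (toMat y.fst * toMat y.snd) - balance L R y * R)

theorem contDiff_balance {N : WithTop ℕ∞} : ContDiff ℝ N (balance L R) :=
  (contDiff_fst_toMat.matrix_transpose.matrix_mul (contDiff_fst_toMat.sub contDiff_const)).sub
    ((contDiff_snd_toMat.sub contDiff_const).matrix_mul contDiff_snd_toMat.matrix_transpose)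

theorem contDiff_normalMap {N : WithTop ℕ∞} : ContDiff ℝ N (normalMap L R) := by
  have h := contDiff_balance L R (N := N)
  have hp : ContDiff ℝ N fun y : FactorSpace m k n => toMat y.fst * toMat y.snd :=
    contDiff_fst_toMat.matrix_mul contDiff_snd_toMat
  exact contDiff_ofPair.comp
    (((hp.matrix_mul contDiff_const).add (contDiff_const.matrix_mul h)).prodMk
      ((contDiff_const.matrix_mul hp).sub (h.matrix_mul contDiff_const)))

theorem balance_self : balance L R (ofPair L R) = 0 := by
  change Lᵀ * (L - L) - (R - R) * Rᵀ = 0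
  simp

theorem normalMap_self : normalMap L R (ofPair L R) = adjointTangent L R (L * R) := by
  rw [normalMap, balance_self, adjointTangent, Matrix.mul_zero, Matrix.zero_mul, add_zero, sub_zero]
  rfl

theorem balance_add_smul (δ : FactorSpace m k n) (t : ℝ) :
    balance L R (ofPair L R + t • δ) =
      t • (Lᵀ * toMat δ.fst - toMat δ.snd * Rᵀ) +
        t ^ 2 • ((toMat δ.fst)ᵀ * toMat δ.fst - toMat δ.snd * (toMat δ.snd)ᵀ) := by
  change (L + t • toMat δ.fst)ᵀ * ((L + t • toMat δ.fst) - L) -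
    ((R + t • toMat δ.snd) - R) * (R + t • toMat δ.snd)ᵀ = _
  simp only [add_sub_cancel_left, transpose_add, transpose_smul, Matrix.add_mul, Matrix.mul_add,
    Matrix.smul_mul, Matrix.mul_smul]
  module

theorem fderiv_normalMap_apply (δ : FactorSpace m k n) :
    fderiv ℝ (normalMap L R) (ofPair L R) δ =
      ofPair ((toMat δ.fst * R + L * toMat δ.snd) * Rᵀ + L * (Lᵀ * toMat δ.fst - toMat δ.snd * Rᵀ))
        (Lᵀ * (toMat δ.fst * R + L * toMat δ.snd) - (Lᵀ * toMat δ.fst - toMat δ.snd * Rᵀ) * R) := by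
  refine fderiv_apply_eq_of_quadratic
    (w := ofPair (toMat δ.fst * toMat δ.snd * Rᵀ + L * ((toMat δ.fst)ᵀ * toMat δ.fst -
      toMat δ.snd * (toMat δ.snd)ᵀ)) (Lᵀ * (toMat δ.fst * toMat δ.snd) -
      ((toMat δ.fst)ᵀ * toMat δ.fst - toMat δ.snd * (toMat δ.snd)ᵀ) * R))
    ((contDiff_normalMap L R (N := 1)).differentiable (by simp) _) fun t => ?_
  rw [normalMap_self, normalMap, balance_add_smul]
  set a := toMat δ.fst
  set b := toMat δ.snd
  set e := Lᵀ * a - b * Rᵀ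
  set f := aᵀ * a - b * bᵀ
  have hp : toMat (ofPair L R + t • δ).fst * toMat (ofPair L R + t • δ).snd =
      L * R + t • (a * R + L * b) + t ^ 2 • (a * b) :=
    congrArg toMat (productMap_add_smul (ofPair L R) δ t)
  rw [hp]
  have h1 : (L * R + t • (a * R + L * b) + t ^ 2 • (a * b)) * Rᵀ + L * (t • e + t ^ 2 • f) =
      L * R * Rᵀ + t • ((a * R + L * b) * Rᵀ + L * e) + t ^ 2 • (a * b * Rᵀ + L * f) := by
    simp only [Matrix.add_mul, Matrix.mul_add, Matrix.smul_mul, Matrix.mul_smul]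
    module
  have h2 : Lᵀ * (L * R + t • (a * R + L * b) + t ^ 2 • (a * b)) - (t • e + t ^ 2 • f) * R =
      Lᵀ * (L * R) + t • (Lᵀ * (a * R + L * b) - e * R) + t ^ 2 • (Lᵀ * (a * b) - f * R) := by
    simp only [Matrix.add_mul, Matrix.mul_add, Matrix.smul_mul, Matrix.mul_smul]
    module
  rw [h1, h2]
  rfl

variable {L R}

theorem trace_adjoint (X : Matrix (Fin m) (Fin n) ℝ) (a : Matrix (Fin m) (Fin k) ℝ)
    (b : Matrix (Fin k) (Fin n) ℝ) :
    ((X * Rᵀ)ᵀ * a).trace + ((Lᵀ * X)ᵀ * b).trace = (Xᵀ * (a * R + L * b)).trace := by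
  rw [Matrix.transpose_mul, Matrix.transpose_mul, Matrix.transpose_transpose,
    Matrix.transpose_transpose, Matrix.mul_add, trace_add, Matrix.mul_assoc R,
    Matrix.trace_mul_comm R, Matrix.mul_assoc Xᵀ a, Matrix.mul_assoc Xᵀ L]

/-- The cross terms of the two squares are the same trace with opposite signs. The four remaining
norms are bounded separately by singular values. -/
theorem norm_sq_tangent_add_norm_sq_balance (a : Matrix (Fin m) (Fin k) ℝ)
    (b : Matrix (Fin k) (Fin n) ℝ) :
    ‖a * R + L * b‖ ^ 2 + ‖Lᵀ * a - b * Rᵀ‖ ^ 2 =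
      ‖a * R‖ ^ 2 + ‖L * b‖ ^ 2 + ‖Lᵀ * a‖ ^ 2 + ‖b * Rᵀ‖ ^ 2 := by
  have h : ((a * R)ᵀ * (L * b)).trace = ((Lᵀ * a)ᵀ * (b * Rᵀ)).trace := by
    rw [Matrix.transpose_mul, Matrix.transpose_mul, Matrix.transpose_transpose,
      Matrix.mul_assoc, Matrix.trace_mul_comm]
    simp only [Matrix.mul_assoc]
  rw [frobenius_norm_add_sq, frobenius_norm_sub_sq, h]
  ring

/-- The derivative is `DG* DG + K K*`; its quadratic form `‖DG δ‖² + ‖K* δ‖²` is at least `minSq L R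
* ‖δ‖²`. -/
theorem fderiv_normalMap_injective (hk : 1 ≤ k) (hL : L.rank = k) (hR : R.rank = k) :
    Function.Injective (fderiv ℝ (normalMap L R) (ofPair L R)) := by
  rw [injective_iff_map_eq_zero]
  intro δ hδ
  set a := toMat δ.fst with ha
  set b := toMat δ.snd with hb
  set D := a * R + L * b with hD
  set e := Lᵀ * a - b * Rᵀ with he
  have h0 : inner ℝ (fderiv ℝ (normalMap L R) (ofPair L R) δ) δ = ‖D‖ ^ 2 + ‖e‖ ^ 2 := by
    rw [fderiv_normalMap_apply, inner_factorSpace]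
    change ((D * Rᵀ + L * e)ᵀ * a).trace + ((Lᵀ * D - e * R)ᵀ * b).trace = _
    have h1 := trace_adjoint (L := L) (R := R) D a b
    have h2 : ((L * e)ᵀ * a).trace - ((e * R)ᵀ * b).trace = (eᵀ * e).trace := by
      rw [Matrix.transpose_mul, Matrix.transpose_mul, he, Matrix.mul_sub, trace_sub,
        Matrix.mul_assoc, Matrix.mul_assoc, Matrix.trace_mul_comm Rᵀ, Matrix.mul_assoc _ b]
    rw [frobenius_norm_sq_eq_trace, frobenius_norm_sq_eq_trace, Matrix.transpose_add,
      Matrix.transpose_sub, Matrix.add_mul, Matrix.sub_mul, trace_add, trace_sub]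
    linarith
  rw [hδ, inner_zero_left, hD, he, norm_sq_tangent_add_norm_sq_balance] at h0
  have h1 := minSq_mul_le hk hL hR a b
  rw [← h0, ha, hb, ← norm_sq_factorSpace] at h1
  have h2 := minSq_pos hk hL hR
  have h3 : ‖δ‖ ^ 2 ≤ 0 := nonpos_of_mul_nonpos_right h1 h2
  exact norm_eq_zero.1 (pow_eq_zero_iff two_ne_zero |>.1 (le_antisymm h3 (sq_nonneg _)))

/-- Eliminating the products gives `Lᵀ L e + e R Rᵀ = 0` for `e = balance L R y`; pairing with `e`
yields `L e = 0`, so `e = 0`. The two products then agree after multiplication by `Lᵀ` on the left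
and by `Rᵀ` on the right, which determines them. -/
theorem eq_of_normalMap_eq (hL : L.rank = k) {y : FactorSpace m k n}
    {A : Matrix (Fin m) (Fin k) ℝ} {B : Matrix (Fin k) (Fin n) ℝ}
    (hAB : IsUnit (Lᵀ * (A * B) * Rᵀ).det)
    (h : normalMap L R y = adjointTangent L R (A * B)) :
    balance L R y = 0 ∧ toMat y.fst * toMat y.snd = A * B := by
  set X := toMat y.fst * toMat y.snd with hX
  set e := balance L R y with he
  have h1 : X * Rᵀ + L * e = A * B * Rᵀ :=
    congrArg (fun z : FactorSpace m k n => toMat z.fst) h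
  have h2 : Lᵀ * X - e * R = Lᵀ * (A * B) :=
    congrArg (fun z : FactorSpace m k n => toMat z.snd) h
  have h3 : Lᵀ * (L * e) + e * R * Rᵀ = 0 := by
    have h4 : L * e = A * B * Rᵀ - X * Rᵀ := eq_sub_of_add_eq' h1
    have h5 : e * R = Lᵀ * X - Lᵀ * (A * B) := by rw [← h2, sub_sub_cancel]
    rw [h4, h5, Matrix.mul_sub, Matrix.sub_mul]
    simp only [Matrix.mul_assoc]
    abel
  have h6 : ‖L * e‖ ^ 2 + ‖e * R‖ ^ 2 = 0 := by
    have h7 := congrArg (fun M => (eᵀ * M).trace) h3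
    simp only [Matrix.mul_add, trace_add, Matrix.mul_zero, trace_zero] at h7
    rw [frobenius_norm_sq_eq_trace, frobenius_norm_sq_eq_trace, ← h7, Matrix.transpose_mul,
      Matrix.transpose_mul, Matrix.mul_assoc, Matrix.mul_assoc Rᵀ, Matrix.trace_mul_comm Rᵀ,
      Matrix.mul_assoc eᵀ]
  have h8 : L * e = 0 := by
    have : ‖L * e‖ ^ 2 = 0 := by nlinarith [sq_nonneg ‖L * e‖, sq_nonneg ‖e * R‖]
    exact norm_eq_zero.1 (pow_eq_zero_iff two_ne_zero |>.1 this)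
  have h9 : e = 0 := mul_left_cancel_of_rank hL (h8.trans (Matrix.mul_zero L).symm)
  rw [h9, Matrix.mul_zero, add_zero] at h1
  rw [h9, Matrix.zero_mul, sub_zero] at h2
  refine ⟨h9, ?_⟩
  have hX' : IsUnit (Lᵀ * X * Rᵀ).det := by rw [h2]; exact hAB
  rw [← rankRetract_mul hAB, ← rankRetract_congr h2 h1]
  exact (rankRetract_mul hX').symm

/-- A multiplier `Z` with `a = Z Bᵀ` and `b = Aᵀ Z`, where `(a, b) = y - (L, R)` and
`y = (A, B)`, if `y` is balanced. -/
def multiplier (L : Matrix (Fin m) (Fin k) ℝ) (R : Matrix (Fin k) (Fin n) ℝ)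
    (y : FactorSpace m k n) : Matrix (Fin m) (Fin n) ℝ :=
  (leftInv (toMat y.fst))ᵀ * (toMat y.snd - R) + (toMat y.fst - L) * (rightInv (toMat y.snd))ᵀ -
    (leftInv (toMat y.fst))ᵀ * ((toMat y.fst)ᵀ * (toMat y.fst - L)) * (rightInv (toMat y.snd))ᵀ

/-- The equations `a = Z Bᵀ` and `b = Aᵀ Z` are compatible because balance says `Aᵀ a = b Bᵀ`. The
subtracted term of `multiplier` removes the overlap of the two partial solutions. -/
theorem multiplier_spec {y : FactorSpace m k n} (hy : y ∈ fullRankPairs m k n)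
    (hb : balance L R y = 0) :
    toMat y.fst - L = multiplier L R y * (toMat y.snd)ᵀ ∧
      toMat y.snd - R = (toMat y.fst)ᵀ * multiplier L R y := by
  have h1 : (toMat y.fst)ᵀ * (leftInv (toMat y.fst))ᵀ = 1 := by
    rw [← Matrix.transpose_mul, leftInv_mul hy.1, Matrix.transpose_one]
  have h2 : (rightInv (toMat y.snd))ᵀ * (toMat y.snd)ᵀ = 1 := by
    rw [← Matrix.transpose_mul, mul_rightInv hy.2, Matrix.transpose_one]
  have h3 := sub_eq_zero.1 hb
  constructor
  · rw [multiplier, h3, Matrix.sub_mul, Matrix.add_mul, Matrix.mul_assoc _ _ (toMat y.snd)ᵀ,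
      Matrix.mul_assoc _ _ (toMat y.snd)ᵀ, Matrix.mul_assoc _ _ (toMat y.snd)ᵀ, h2, Matrix.mul_one,
      Matrix.mul_one, add_sub_cancel_left]
  · rw [multiplier, Matrix.mul_sub, Matrix.mul_add, ← Matrix.mul_assoc, ← Matrix.mul_assoc,
      ← Matrix.mul_assoc, ← Matrix.mul_assoc (toMat y.fst)ᵀ, h1, Matrix.one_mul, Matrix.one_mul,
      Matrix.mul_assoc, add_sub_cancel_right]

theorem eventually_norm_multiplier_lt_one (hL : L.rank = k) (hR : R.rank = k) :
    ∀ᶠ y in 𝓝 (ofPair L R), ‖multiplier L R y‖ < 1 := by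
  have hfst := (contDiff_fst_toMat (m := m) (k := k) (n := n) (N := 0))
  have hsnd := (contDiff_snd_toMat (m := m) (k := k) (n := n) (N := 0))
  have h1 : ContDiffAt ℝ 0 (fun y : FactorSpace m k n => leftInv (toMat y.fst)) (ofPair L R) :=
    ((hfst.matrix_transpose.matrix_mul hfst).contDiffAt.matrix_inv
      (by exact (rank_eq_width_iff_isUnit L).1 hL)).matrix_mul hfst.matrix_transpose.contDiffAt
  have h2 : ContDiffAt ℝ 0 (fun y : FactorSpace m k n => rightInv (toMat y.snd)) (ofPair L R) :=
    hsnd.matrix_transpose.contDiffAt.matrix_mul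
      ((hsnd.matrix_mul hsnd.matrix_transpose).contDiffAt.matrix_inv
        (by exact (rank_eq_height_iff_isUnit R).1 hR))
  have h1' := (contDiff_id.matrix_transpose.contDiffAt).comp _ h1
  have h2' := (contDiff_id.matrix_transpose.contDiffAt).comp _ h2
  have ha := (hfst.sub (contDiff_const (c := L))).contDiffAt (x := ofPair L R)
  have hb := (hsnd.sub (contDiff_const (c := R))).contDiffAt (x := ofPair L R)
  have hc : ContinuousAt (multiplier L R) (ofPair L R) :=
    (((h1'.matrix_mul hb).add (ha.matrix_mul h2')).sub ((h1'.matrix_mul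
      (hfst.matrix_transpose.contDiffAt.matrix_mul ha)).matrix_mul h2')).continuousAt
  have h0 : multiplier L R (ofPair L R) = 0 := by
    change (leftInv L)ᵀ * (R - R) + (L - L) * (rightInv R)ᵀ -
      (leftInv L)ᵀ * (Lᵀ * (L - L)) * (rightInv R)ᵀ = 0
    simp
  refine hc.norm.eventually_lt continuousAt_const ?_
  rw [h0, norm_zero]
  exact one_pos

/-- A balanced point with a small multiplier is the unique point of its fibre closest to
`(L, R)`. -/
theorem norm_sub_lt_of_multiplier {y z : FactorSpace m k n} {Z : Matrix (Fin m) (Fin n) ℝ}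
    (hZ : ‖Z‖ < 1) (h1 : toMat y.fst - L = Z * (toMat y.snd)ᵀ)
    (h2 : toMat y.snd - R = (toMat y.fst)ᵀ * Z)
    (hz : toMat z.fst * toMat z.snd = toMat y.fst * toMat y.snd) (hne : z ≠ y) :
    ‖y - ofPair L R‖ < ‖z - ofPair L R‖ := by
  set A := toMat y.fst with hA
  set B := toMat y.snd with hB
  set a := toMat z.fst - A with ha
  set b := toMat z.snd - B with hb
  have hab : a * B + A * b = -(a * b) := by
    have : a * B + A * b + a * b = toMat z.fst * toMat z.snd - A * B := by
      rw [ha, hb]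
      simp only [Matrix.sub_mul, Matrix.mul_sub]
      abel
    rw [hz, sub_self] at this
    exact eq_neg_of_add_eq_zero_left this
  have hy : ‖y - ofPair L R‖ ^ 2 = ‖A - L‖ ^ 2 + ‖B - R‖ ^ 2 := norm_sq_factorSpace _
  have hz' : ‖z - ofPair L R‖ ^ 2 = ‖(A - L) + a‖ ^ 2 + ‖(B - R) + b‖ ^ 2 := by
    rw [norm_sq_factorSpace]
    change ‖toMat z.fst - L‖ ^ 2 + ‖toMat z.snd - R‖ ^ 2 = _
    rw [ha, hb, sub_add_sub_comm, add_comm A, add_sub_add_right_eq_sub, sub_add_sub_comm,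
      add_comm B, add_sub_add_right_eq_sub]
  have hpos : 0 < ‖a‖ ^ 2 + ‖b‖ ^ 2 := by
    have h3 : ‖z - y‖ ^ 2 = ‖a‖ ^ 2 + ‖b‖ ^ 2 := norm_sq_factorSpace _
    rw [← h3]
    have := norm_pos_iff.2 (sub_ne_zero.2 hne)
    positivity
  -- On the fibre `a B + A b = -a b`, so the cross term becomes quadratic in `(a, b)`, and `‖Z‖ < 1`
  -- lets `‖a‖² + ‖b‖²` dominate it.
  have htr : ((A - L)ᵀ * a).trace + ((B - R)ᵀ * b).trace = -(Zᵀ * (a * b)).trace := by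
    have := trace_adjoint (L := A) (R := B) Z a b
    rw [h1, h2, this, hab, Matrix.mul_neg, trace_neg]
  have habs : |(Zᵀ * (a * b)).trace| ≤ ‖Z‖ * (‖a‖ * ‖b‖) :=
    (abs_trace_transpose_mul_le Z (a * b)).trans
      (mul_le_mul_of_nonneg_left (Matrix.frobenius_norm_mul a b) (norm_nonneg _))
  have hle := (le_abs_self _).trans habs
  refine lt_of_pow_lt_pow_left₀ 2 (norm_nonneg _) ?_
  rw [hy, hz', frobenius_norm_add_sq, frobenius_norm_add_sq]
  have h4 : 2 * (‖Z‖ * (‖a‖ * ‖b‖)) ≤ ‖Z‖ * (‖a‖ ^ 2 + ‖b‖ ^ 2) := by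
    have := mul_le_mul_of_nonneg_left (two_mul_le_add_sq ‖a‖ ‖b‖) (norm_nonneg Z)
    linarith
  have h5 : ‖Z‖ * (‖a‖ ^ 2 + ‖b‖ ^ 2) < 1 * (‖a‖ ^ 2 + ‖b‖ ^ 2) :=
    mul_lt_mul_of_pos_right hZ hpos
  linarith

end Balance

/-! ### The least-squares section and the two bounds for the condition number. -/

section Main

open Matrix Filter

attribute [local instance] Matrix.frobeniusNormedAddCommGroup Matrix.frobeniusNormedSpace

variable {m k n : ℕ} {L : Matrix (Fin m) (Fin k) ℝ} {R : Matrix (Fin k) (Fin n) ℝ}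

theorem contDiff_adjointTangent {N : WithTop ℕ∞} :
    ContDiff ℝ N (fun x : MatSpace m n => adjointTangent L R (toMat x)) :=
  contDiff_ofPair.comp ((contDiff_toMat.matrix_mul contDiff_const).prodMk
    (contDiff_const.matrix_mul contDiff_toMat))

/-- Smooth local solution of the least-squares problem, characterised by `balance`. -/
theorem exists_balanced_section (hk : 1 ≤ k) (hL : L.rank = k) (hR : R.rank = k)
    {B : Set (FactorSpace m k n)} (hB : B ∈ 𝓝 (ofPair L R)) :
    ∃ (V : Set (MatSpace m n)) (H : MatSpace m n → FactorSpace m k n), IsOpen V ∧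
      productMap m k n (ofPair L R) ∈ V ∧ ContDiffOn ℝ ∞ H V ∧
      H (productMap m k n (ofPair L R)) = ofPair L R ∧
      ∀ x ∈ Set.range (productMap m k n) ∩ V,
        H x ∈ B ∧ productMap m k n (H x) = x ∧ balance L R (H x) = 0 := by
  obtain ⟨T, g, hT, hyT, hg, hgy, hfg⟩ := exists_smooth_local_rightInverse
    (contDiff_normalMap L R).contDiffAt (fderiv_normalMap_injective hk hL hR)
  set D : MatSpace m n → FactorSpace m k n := fun x => adjointTangent L R (toMat x) with hD
  have hDc : Continuous D := (contDiff_adjointTangent (N := 0)).continuous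
  have hDx : D (productMap m k n (ofPair L R)) = normalMap L R (ofPair L R) :=
    (normalMap_self L R).symm
  obtain ⟨B', hB'B, hB'o, hyB'⟩ := mem_nhds_iff.1 hB
  set O : Set (MatSpace m n) := {x | IsUnit (Lᵀ * toMat x * Rᵀ).det} with hO
  have hTB : IsOpen (T ∩ g ⁻¹' B') := hg.continuousOn.isOpen_inter_preimage hT hB'o
  refine ⟨O ∩ D ⁻¹' (T ∩ g ⁻¹' B'), g ∘ D, (isOpen_isUnit_det _ _).inter (hTB.preimage hDc),
    ⟨?_, ?_⟩, ?_, ?_, ?_⟩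
  · change IsUnit (Lᵀ * (L * R) * Rᵀ).det
    rw [← Matrix.mul_assoc, Matrix.mul_assoc, Matrix.det_mul]
    exact ((rank_eq_width_iff_isUnit L).1 hL).mul ((rank_eq_height_iff_isUnit R).1 hR)
  · rw [Set.mem_preimage, hDx]
    exact ⟨hyT, by rw [Set.mem_preimage, hgy]; exact hyB'⟩
  · exact hg.comp contDiff_adjointTangent.contDiffOn fun x hx => hx.2.1
  · rw [Function.comp_apply, hDx, hgy]
  · rintro _ ⟨⟨y, rfl⟩, hxO, hxT, hxB⟩
    obtain ⟨h1, h2⟩ := eq_of_normalMap_eq (R := R) hL (y := g (D (productMap m k n y))) hxO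
      (hfg _ hxT)
    exact ⟨hB'B hxB, congrArg ofMat h2, h1⟩

/-- For balanced `y`, the distance of `y` to `(L, R)` is controlled by that of the products. -/
theorem norm_sub_mul_le_of_balanced (hk : 1 ≤ k) (hL : L.rank = k) (hR : R.rank = k)
    {y : FactorSpace m k n} (hb : balance L R y = 0) :
    ‖y - ofPair L R‖ * (√(minSq L R) - 2 * ‖y - ofPair L R‖) ≤
      ‖productMap m k n y - productMap m k n (ofPair L R)‖ := by
  set δ := y - ofPair L R with hδ
  set a := toMat δ.fst with ha
  set b := toMat δ.snd with hb'
  set ξ := ‖productMap m k n y - productMap m k n (ofPair L R)‖ with hξ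
  have hy : y = ofPair L R + (1 : ℝ) • δ := by rw [one_smul, hδ, add_sub_cancel]
  have hN : ‖δ‖ ^ 2 = ‖a‖ ^ 2 + ‖b‖ ^ 2 := norm_sq_factorSpace δ
  have hab : 2 * (‖a‖ * ‖b‖) ≤ ‖δ‖ ^ 2 := by
    have := two_mul_le_add_sq ‖a‖ ‖b‖
    linarith
  have hab0 : 0 ≤ ‖a‖ * ‖b‖ := by positivity
  have h1 : ‖a * R + L * b‖ ≤ ξ + ‖δ‖ ^ 2 := by
    have h2 : a * R + L * b = toMat (productMap m k n y - productMap m k n (ofPair L R)) - a * b := by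
      have := productMap_add_smul (ofPair L R) δ 1
      rw [← hy, one_smul, one_pow, one_smul] at this
      rw [this, add_assoc, add_sub_cancel_left]
      change a * R + L * b = (a * R + L * b + a * b) - a * b
      rw [add_sub_cancel_right]
    calc ‖a * R + L * b‖ ≤ ξ + ‖a * b‖ := by
          rw [h2, hξ, ← norm_toMat]; exact norm_sub_le _ _
      _ ≤ ξ + ‖δ‖ ^ 2 := by
          have := Matrix.frobenius_norm_mul a b
          linarith
  -- For balanced `y` the linear part of `balance` is minus its quadratic part.
  have h3 : ‖Lᵀ * a - b * Rᵀ‖ ≤ ‖δ‖ ^ 2 := by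
    have h4 := balance_add_smul L R δ 1
    rw [← hy, hb, one_smul, one_pow, one_smul] at h4
    rw [eq_neg_of_add_eq_zero_left h4.symm, norm_neg, hN]
    refine (norm_sub_le _ _).trans (add_le_add ?_ ?_)
    · refine (Matrix.frobenius_norm_mul _ _).trans_eq ?_
      rw [Matrix.frobenius_norm_transpose, sq]
    · refine (Matrix.frobenius_norm_mul _ _).trans_eq ?_
      rw [Matrix.frobenius_norm_transpose, sq]
  have h5 : (√(minSq L R) * ‖δ‖) ^ 2 ≤ (ξ + 2 * ‖δ‖ ^ 2) ^ 2 := by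
    have h6 := minSq_mul_le hk hL hR a b
    rw [← norm_sq_tangent_add_norm_sq_balance, ← hN] at h6
    have h7 : ‖a * R + L * b‖ ^ 2 ≤ (ξ + ‖δ‖ ^ 2) ^ 2 := pow_le_pow_left₀ (norm_nonneg _) h1 2
    have h8 : ‖Lᵀ * a - b * Rᵀ‖ ^ 2 ≤ (‖δ‖ ^ 2) ^ 2 := pow_le_pow_left₀ (norm_nonneg _) h3 2
    have h9 : 0 ≤ ξ * ‖δ‖ ^ 2 := by positivity
    rw [mul_pow, Real.sq_sqrt (minSq_pos hk hL hR).le]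
    nlinarith [sq_nonneg (‖δ‖ ^ 2)]
  have h10 := le_of_sq_le_sq h5 (by positivity)
  linarith

/-- Continuity of `H` makes the correction `2 * ‖H x - ofPair L R‖` to `√(minSq L R)` negligible, at
the cost of `ε`. -/
theorem eventually_norm_sub_le (hk : 1 ≤ k) (hL : L.rank = k) (hR : R.rank = k)
    {S : Set (MatSpace m n)} {H : MatSpace m n → FactorSpace m k n}
    (hc : ContinuousAt H (productMap m k n (ofPair L R)))
    (hH0 : H (productMap m k n (ofPair L R)) = ofPair L R)
    (hH : ∀ᶠ x in 𝓝[S] (productMap m k n (ofPair L R)),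
      productMap m k n (H x) = x ∧ balance L R (H x) = 0) {ε : ℝ} (hε : 0 < ε) :
    ∀ᶠ x in 𝓝[S] (productMap m k n (ofPair L R)), ‖H x - ofPair L R‖ ≤
      (1 / √(minSq L R) + ε) * ‖x - productMap m k n (ofPair L R)‖ := by
  have hs : 0 < √(minSq L R) := Real.sqrt_pos.2 (minSq_pos hk hL hR)
  have hlt : ∀ᶠ x in 𝓝 (productMap m k n (ofPair L R)),
      1 < (1 / √(minSq L R) + ε) * (√(minSq L R) - 2 * ‖H x - ofPair L R‖) := by
    have : ContinuousAt (fun x => (1 / √(minSq L R) + ε) *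
        (√(minSq L R) - 2 * ‖H x - ofPair L R‖)) (productMap m k n (ofPair L R)) :=
      continuousAt_const.mul (continuousAt_const.sub
        (continuousAt_const.mul (hc.sub continuousAt_const).norm))
    refine continuousAt_const.eventually_lt this ?_
    rw [hH0, sub_self, norm_zero, mul_zero, sub_zero, add_mul, one_div_mul_cancel hs.ne']
    linarith [mul_pos hε hs]
  filter_upwards [hH, mem_nhdsWithin_of_mem_nhds hlt] with x hx hx'
  have h1 := norm_sub_mul_le_of_balanced hk hL hR hx.2
  rw [hx.1] at h1
  have h2 := mul_le_mul_of_nonneg_left h1 (show 0 ≤ 1 / √(minSq L R) + ε by positivity)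
  have h3 := mul_le_mul_of_nonneg_left hx'.le
    (norm_nonneg (H x - ofPair L R))
  linarith

/-- No solution path over the curve `t ↦ G ((L, R) + t v)` is asymptotically shorter than `v`, if
`v` is in the range of the adjoint of the derivative of `G`. -/
theorem norm_adjointTangent_le_of_eventually {X : Matrix (Fin m) (Fin n) ℝ} {M : ℝ}
    {y : ℝ → FactorSpace m k n} (hv : adjointTangent L R X ≠ 0)
    (h : ∀ᶠ t in 𝓝[>] (0 : ℝ),
      productMap m k n (y t) = productMap m k n (ofPair L R + t • adjointTangent L R X) ∧
      ‖y t - ofPair L R‖ ≤ M * t) :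
    ‖adjointTangent L R X‖ ≤ M := by
  set v := adjointTangent L R X with hv'
  have hinner : ∀ δ : FactorSpace m k n,
      inner ℝ v δ = (Xᵀ * (toMat δ.fst * R + L * toMat δ.snd)).trace := fun δ => by
    rw [inner_factorSpace, ← trace_adjoint]; rfl
  have hvpos : 0 < ‖v‖ := norm_pos_iff.2 hv
  have hmul : ∀ δ : FactorSpace m k n, ‖toMat δ.fst * toMat δ.snd‖ ≤ ‖δ‖ ^ 2 := fun δ => by
    refine (Matrix.frobenius_norm_mul _ _).trans ?_
    rw [norm_sq_factorSpace]
    nlinarith [sq_nonneg (‖toMat δ.fst‖ - ‖toMat δ.snd‖), sq_nonneg ‖toMat δ.fst‖,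
      sq_nonneg ‖toMat δ.snd‖]
  -- Pairing both expansions of the product with `X` gives `t ‖v‖² + O(t²) = ⟨v, δ⟩ + O(‖δ‖²)`;
  -- Cauchy–Schwarz and division by `t` finish.
  have key : ∀ᶠ t in 𝓝[>] (0 : ℝ), ‖v‖ ^ 2 ≤ ‖v‖ * M + t * (‖X‖ * (‖v‖ ^ 2 + M ^ 2)) := by
    filter_upwards [h, self_mem_nhdsWithin] with t ht ht0
    have htpos : (0 : ℝ) < t := ht0
    set δ := y t - ofPair L R with hδ
    have h1 := productMap_add_smul (ofPair L R) δ 1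
    have h2 := productMap_add_smul (ofPair L R) v t
    rw [one_smul, hδ, add_sub_cancel, ht.1, h2, ← hδ, one_smul, one_pow, one_smul, add_assoc,
      add_assoc, add_right_inj] at h1
    have h3 : t • (toMat v.fst * R + L * toMat v.snd) + t ^ 2 • (toMat v.fst * toMat v.snd) =
        toMat δ.fst * R + L * toMat δ.snd + toMat δ.fst * toMat δ.snd := ofMat_injective h1
    have h4 := congrArg (fun M => (Xᵀ * M).trace) h3
    simp only [Matrix.mul_add Xᵀ (_ • _), Matrix.mul_add Xᵀ (_ + _), trace_add, Matrix.mul_smul,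
      trace_smul, smul_eq_mul] at h4
    rw [← hinner, ← hinner, real_inner_self_eq_norm_sq] at h4
    have h5 := (neg_abs_le _).trans' (neg_le_neg ((abs_trace_transpose_mul_le X
      (toMat v.fst * toMat v.snd)).trans (mul_le_mul_of_nonneg_left (hmul v) (norm_nonneg X))))
    have h6 := (le_abs_self _).trans ((abs_trace_transpose_mul_le X
      (toMat δ.fst * toMat δ.snd)).trans (mul_le_mul_of_nonneg_left (hmul δ) (norm_nonneg X)))
    have h7 : inner ℝ v δ ≤ ‖v‖ * (M * t) :=
      (real_inner_le_norm v δ).trans (mul_le_mul_of_nonneg_left ht.2 (norm_nonneg v))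
    have h8 : ‖X‖ * ‖δ‖ ^ 2 ≤ ‖X‖ * (M * t) ^ 2 :=
      mul_le_mul_of_nonneg_left (pow_le_pow_left₀ (norm_nonneg _) ht.2 2) (norm_nonneg X)
    have h9 := mul_le_mul_of_nonneg_left h5 (sq_nonneg t)
    refine le_of_mul_le_mul_left ?_ htpos
    linarith
  have hlim : Tendsto (fun t : ℝ => ‖v‖ * M + t * (‖X‖ * (‖v‖ ^ 2 + M ^ 2))) (𝓝[>] 0)
      (𝓝 (‖v‖ * M + 0 * (‖X‖ * (‖v‖ ^ 2 + M ^ 2)))) :=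
    (Continuous.tendsto (by fun_prop) 0).mono_left nhdsWithin_le_nhds
  have h10 := ge_of_tendsto hlim key
  rw [zero_mul, add_zero, sq] at h10
  exact le_of_mul_le_mul_left h10 hvpos

theorem norm_sq_adjointTangent {X : Matrix (Fin m) (Fin n) ℝ} {μ : ℝ}
    (hX : X * Rᵀ * R + L * (Lᵀ * X) = μ • X) : ‖adjointTangent L R X‖ ^ 2 = μ * ‖X‖ ^ 2 := by
  have h := trace_adjoint (L := L) (R := R) X (X * Rᵀ) (Lᵀ * X)
  rw [hX, Matrix.mul_smul, trace_smul, ← frobenius_norm_sq_eq_trace, ← frobenius_norm_sq_eq_trace,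
    ← frobenius_norm_sq_eq_trace] at h
  rw [norm_sq_factorSpace]
  exact h

theorem hasLSConditionNumber_productMap (hk : 1 ≤ k) (hL : L.rank = k) (hR : R.rank = k)
    {W : Set (FactorSpace m k n)} (hW : IsOpen W) (hyW : ofPair L R ∈ W)
    (hWr : W ⊆ fullRankPairs m k n) :
    HasLSConditionNumber (productMap m k n '' W) W (fun x y => productMap m k n y - x) 0
      (productMap m k n (ofPair L R)) (ofPair L R) (1 / √(minSq L R)) := by
  have hμ := minSq_pos hk hL hR
  have hs : 0 < √(minSq L R) := Real.sqrt_pos.2 hμ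
  obtain ⟨r, hr, hrW⟩ := Metric.isOpen_iff.1 hW _ hyW
  obtain ⟨V, H, hVo, hxV, hHs, hH0, hH⟩ := exists_balanced_section hk hL hR
    (Filter.inter_mem (Metric.ball_mem_nhds (ofPair L R) hr)
      (eventually_norm_multiplier_lt_one hL hR))
  have himg : ∀ x ∈ productMap m k n '' W ∩ V, x ∈ Set.range (productMap m k n) ∩ V :=
    fun x hx => ⟨Set.image_subset_range _ _ hx.1, hx.2⟩
  obtain ⟨X, hX0, hX⟩ := exists_eigenmatrix hk hL hR
  set v := adjointTangent L R X with hv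
  have hXpos : 0 < ‖X‖ := norm_pos_iff.2 hX0
  have hnv : ‖v‖ = √(minSq L R) * ‖X‖ := by
    rw [← Real.sqrt_sq (norm_nonneg v), norm_sq_adjointTangent hX, Real.sqrt_mul hμ.le,
      Real.sqrt_sq hXpos.le]
  have hv0 : v ≠ 0 := norm_pos_iff.1 (hnv ▸ mul_pos hs hXpos)
  have hpath : Continuous fun t : ℝ => ofPair L R + t • v := by fun_prop
  have hc : ContDiff ℝ 1 fun t : ℝ => productMap m k n (ofPair L R + t • v) :=
    contDiff_productMap.comp (by fun_prop)
  have hderiv : deriv (fun t : ℝ => productMap m k n (ofPair L R + t • v)) 0 =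
      minSq L R • ofMat X := by
    rw [(hasDerivAt_zero_of_quadratic (productMap_add_smul (ofPair L R) v)).deriv]
    exact congrArg ofMat hX
  have hnd : ‖minSq L R • ofMat X‖ = minSq L R * ‖X‖ := by
    rw [norm_smul, norm_ofMat, Real.norm_of_nonneg hμ.le]
  refine hasLSConditionNumber_of_section (c := fun t : ℝ => productMap m k n (ofPair L R + t • v))
    hrW hVo hxV hHs (fun x hx => (hH x (himg x hx)).1.1) (fun x hx => (hH x (himg x hx)).2.1)
    ?_ (by positivity) ?_ hc (by simp) ?_ ?_ ?_
  · intro x hx y hy hyx hne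
    obtain ⟨⟨hb, hZ⟩, hs, hbal⟩ := hH x (himg x hx)
    obtain ⟨h1, h2⟩ := multiplier_spec (hWr (hrW hb)) hbal
    exact norm_sub_lt_of_multiplier hZ h1 h2 (ofMat_injective (hyx.trans hs.symm)) hne
  · intro ε hε
    refine eventually_norm_sub_le hk hL hR
      (hHs.continuousOn.continuousAt (hVo.mem_nhds hxV)) hH0 ?_ hε
    filter_upwards [self_mem_nhdsWithin, mem_nhdsWithin_of_mem_nhds (hVo.mem_nhds hxV)]
      with x hx hx'
    exact (hH x (himg x ⟨hx, hx'⟩)).2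
  · have : ∀ᶠ t in 𝓝 (0 : ℝ), ofPair L R + t • v ∈ W :=
      hpath.continuousAt.eventually_mem (hW.mem_nhds (by simpa using hyW))
    exact this.mono fun t ht => Set.mem_image_of_mem _ ht
  · rw [hderiv, ← norm_pos_iff, hnd]
    positivity
  · intro M y hy
    have h1 := norm_adjointTangent_le_of_eventually hv0 hy
    rw [hderiv, hnd]
    -- With `μ = minSq L R`, the required equality is `(1 / √μ) * (μ * ‖X‖) = √μ * ‖X‖`, and the
    -- right side is `‖v‖`.
    refine le_of_eq_of_le ?_ (hnv ▸ h1)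
    rw [one_div, ← mul_assoc]
    congr 1
    nth_rw 2 [← Real.mul_self_sqrt hμ.le]
    rw [inv_mul_cancel_left₀ hs.ne']

theorem hasLSInvConditionNumber_productMap (hk : 1 ≤ k) (hL : L.rank = k) (hR : R.rank = k) :
    HasLSInvConditionNumber (productMap m k n) (fullRankPairs m k n) (ofPair L R)
      (1 / √(minSq L R)) :=
  ⟨isConstantRankMap_productMap,
    ⟨fullRankPairs m k n, isOpen_fullRankPairs, ⟨hL, hR⟩, subset_rfl,
      isEmbeddedSubmanifold_productMap_image isOpen_fullRankPairs subset_rfl⟩,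
    fun _ hW => hasLSConditionNumber_productMap hk hL hR hW.1 hW.2.1 hW.2.2.1⟩

theorem one_div_sqrt_minSq_of_lt (hL : L.rank = k) (hR : R.rank = k) (h : k < min m n) :
    1 / √(minSq L R) = (min (sigma L k) (sigma R k))⁻¹ := by
  -- The zero-based index is `m - 1 ≥ k`, beyond the rank; likewise `n - 1 ≥ k` for `R`.
  have hm : sigma L m = 0 := le_antisymm
    (not_lt.1 fun h' => by rw [sigma_pos_iff] at h'; omega) (sigma_nonneg L m)
  have hn : sigma R n = 0 := le_antisymm
    (not_lt.1 fun h' => by rw [sigma_pos_iff] at h'; omega) (sigma_nonneg R n)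
  rw [one_div, minSq, hm, hn, zero_pow two_ne_zero, add_zero, zero_add,
    Monotone.map_min fun _ _ h => Real.sqrt_le_sqrt h, Real.sqrt_sq (sigma_nonneg L k), Real.sqrt_sq (sigma_nonneg R k)]

end Main

end LSCond
end

theorem mainTheorem4 (m k n : ℕ) (hk : 1 ≤ k)
    (L : Matrix (Fin m) (Fin k) ℝ) (R : Matrix (Fin k) (Fin n) ℝ)
    (hL : L.rank = k) (hR : R.rank = k) :
    LSCond.HasLSInvConditionNumber (LSCond.productMap m k n) (LSCond.fullRankPairs m k n)
      (LSCond.ofPair L R)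
      (1 / √(min (LSCond.sigma L k ^ 2 + LSCond.sigma R n ^ 2)
        (LSCond.sigma L m ^ 2 + LSCond.sigma R k ^ 2))) ∧
    (k < min m n →
      LSCond.HasLSInvConditionNumber (LSCond.productMap m k n) (LSCond.fullRankPairs m k n)
        (LSCond.ofPair L R) (min (LSCond.sigma L k) (LSCond.sigma R k))⁻¹) := by
  have h := LSCond.hasLSInvConditionNumber_productMap hk hL hR
  refine ⟨h, fun hlt => ?_⟩
  rwa [LSCond.one_div_sqrt_minSq_of_lt hL hR hlt] at h
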